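/- Let $d\ge 3$ be an integer. All observables are projectors (Hermitian idempotent complex matrices), with outcomes $0$ and $1$; two of them are compatible if they commute. For projectors $S=(\Pi_i)_{i=1}^n$, the graph of compatibility has vertex set $\{1,\dots,n\}$ and an edge between $i\ne j$ exactly when $\Pi_i$ and $\Pi_j$ commute. Given a graph $G=(V,E)$ with $V=\{1,\dots,n\}$, vertex weights $w_i>0$ and edge weights $w_{ij}=w_{ji}\ge\max(w_i,w_j)$, put $$\mathcal W=\sum_{i\in V}w_iP_i-\sum_{(i,j)\in E}w_{ij}P_{ij},$$ each edge being counted once. In quantum theory, $P_i=\operatorname{tr}(\rho\,\Pi_i)$ is the probability of outcome $1$ of $\Pi_i$ in the state $\rho$ and $P_{ij}=\operatorname{tr}(\rho\,\Pi_i\Pi_j)$ the joint probability of outcomes $1$ and $1$ of the compatible observables $\Pi_i,\Pi_j$; the value is written $\mathcal W(S,\rho)$. In a noncontextual hidden-variable (NCHV) theory there are events $A_1,\dots,A_n$ in a probability space $(\Lambda,\mu)$ with $P_i=\mu(A_i)$ and $P_{ij}=\mu(A_i\cap A_j)$. The weighted independence number $\alpha(G,\vec w)$ is the maximum of $\sum_{i\in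 I}w_i$ over the independent sets $I$ of $G$. Then there exist a finite set $S=\{\Pi_i\}_{i=1}^n$ of distinct projectors on $\mathbb C^d$, a functional $\mathcal W$ of the above form on the graph of compatibility $G$ of $S$, and real numbers $Q$ and $C$ such that: 1. $\mathcal W(S,\rho)=Q$ for every state $\rho$ on $\mathbb C^d$ (a positive semidefinite matrix of trace $1$). 2. $C=\alpha(G,\vec w)$ is the largest value of $\mathcal W$ in NCHV theories, and $Q>C$; so $\mathcal W\le C$ is a noncontextuality inequality that every state violates. 3. (Certification with any full-rank state.) Let $D$ be any dimension, $S'=(\Pi'_i)_{i=1}^n$ projectors on $\mathbb C^D$ such that $\Pi'_i$ and $\Pi'_j$ are compatible whenever $(i,j)$ is an edge of $G$, and $\rho'$ a state on $\mathbb C^D$ of rank $D$. If $\mathcal W(S',\rho')=Q$, then there are integers $d_1,d_2\ge0$ with $D=d\,(d_1+d_2)$ and a unitary $U$ such that, for all $i$, $$U\,\Pi'_i\,U^\dagger=\Pi_i\otimes\mathbb 1^{d_1}\ \oplus\ \Pi_i^*\otimes\mathbb 1^{d_2},$$ where $\Pi_i^*$ is the entrywise complex conjugate of $\Pi_i$.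 If all the $\Pi_i$ are real matrices, there is moreover a unitary $U$ with $U\,\Pi'_i\,U^\dagger=\Pi_i\otimes\mathbb 1^{D/d}$ for all $i$. 4. If $d\ge4$, then $S$ consists of real matrices. -/

import Mathlib

open scoped ComplexOrder Kronecker Matrix

noncomputable section

namespace CFR

/-- A density matrix (quantum state) in dimension `d`. -/
def IsState {d : ℕ} (ρ : Matrix (Fin d) (Fin d) ℂ) : Prop :=
  ρ.PosSemidef ∧ ρ.trace = 1

/-- Born rule: the probability that the observable represented by the projector `P` has
outcome `1` in the state `ρ`. -/
def prob {d : ℕ} (ρ P : Matrix (Fin d) (Fin d) ℂ) : ℝ :=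
  (ρ * P).trace.re

/-- Born rule: the joint probability that the compatible observables represented by the commuting
projectors `P` and `R` both have outcome `1` in the state `ρ`. -/
def jointProb {d : ℕ} (ρ P R : Matrix (Fin d) (Fin d) ℂ) : ℝ :=
  (ρ * (P * R)).trace.re

/-- The graph of compatibility of a family of projectors: two distinct indices are adjacent iff
the corresponding projectors commute. -/
def compatGraph {d n : ℕ} (S : Fin n → Matrix (Fin d) (Fin d) ℂ) : SimpleGraph (Fin n) where
  Adj i j := i ≠ j ∧ Commute (S i) (S j)
  symm := ⟨fun _ _ h => ⟨h.1.symm, h.2.symm⟩⟩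
  loopless := ⟨fun _ h => h.1 rfl⟩

/-- The weighted independence number: the maximal total weight of an independent set. -/
def weightedIndepNum {n : ℕ} (G : SimpleGraph (Fin n)) (w : Fin n → ℝ) : ℝ :=
  sSup {x : ℝ | ∃ s : Finset (Fin n), G.IsIndepSet (s : Set (Fin n)) ∧ x = ∑ i ∈ s, w i}

/-- The data of a functional `∑ i, w i * P i - ∑ (i, j) ∈ E, wE i j * P i j` on a graph:
positive vertex weights, and edge weights that dominate the weights of both end points. -/
structure Witness (n : ℕ) where
  graph : SimpleGraph (Fin n)
  w : Fin n → ℝ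
  wE : Fin n → Fin n → ℝ
  w_pos : ∀ i, 0 < w i
  wE_symm : ∀ i j, wE i j = wE j i
  le_wE : ∀ i j, graph.Adj i j → max (w i) (w j) ≤ wE i j

namespace Witness

variable {n : ℕ} (W : Witness n)

open Classical in
/-- The functional evaluated on single probabilities `p i` and joint probabilities `q i j`.
Each edge is counted once. -/
def eval (p : Fin n → ℝ) (q : Fin n → Fin n → ℝ) : ℝ :=
  ∑ i, W.w i * p i - ∑ i, ∑ j, if i < j ∧ W.graph.Adj i j then W.wE i j * q i j else 0

/-- The value `𝒲(S, ρ)` in quantum theory. -/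
def value {d : ℕ} (S : Fin n → Matrix (Fin d) (Fin d) ℂ) (ρ : Matrix (Fin d) (Fin d) ℂ) : ℝ :=
  W.eval (fun i => prob ρ (S i)) (fun i j => jointProb ρ (S i) (S j))

/-- The values of the functional in noncontextual hidden-variable theories: a hidden variable
ranges over a probability space `Λ`, and the observable `i` has outcome `1` exactly for the hidden
variables in the event `A i`, whatever it is measured together with. -/
def nchvValues : Set ℝ :=
  {x : ℝ | ∃ (Λ : Type) (_ : MeasurableSpace Λ) (μ : MeasureTheory.Measure Λ)
    (A : Fin n → Set Λ), MeasureTheory.IsProbabilityMeasure μ ∧ (∀ i, MeasurableSet (A i)) ∧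
      x = W.eval (fun i => μ.real (A i)) (fun i j => μ.real (A i ∩ A j))}

/-- `S` is a quantum realization of the scenario of `W` in dimension `D`: each observable is a
projector, and observables that are adjacent in the graph (those whose joint probabilities `W`
refers to) are compatible. -/
def IsRealization {D : ℕ} (S : Fin n → Matrix (Fin D) (Fin D) ℂ) : Prop :=
  (∀ i, IsStarProjection (S i)) ∧ ∀ i j, W.graph.Adj i j → Commute (S i) (S j)

end Witness

/-- `U Π'ᵢ U† = Πᵢ ⊗ 1^{d₁} ⊕ Πᵢ* ⊗ 1^{d₂}` for all `i` and one unitary `U`, where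
`D = d (d₁ + d₂)` and `Πᵢ*` is the entrywise complex conjugate. -/
def EquivUpToConj {d D n : ℕ} (S : Fin n → Matrix (Fin d) (Fin d) ℂ)
    (S' : Fin n → Matrix (Fin D) (Fin D) ℂ) : Prop :=
  ∃ d₁ d₂ : ℕ, D = d * (d₁ + d₂) ∧
    ∃ U : Matrix ((Fin d × Fin d₁) ⊕ (Fin d × Fin d₂)) (Fin D) ℂ,
      U * Uᴴ = 1 ∧ Uᴴ * U = 1 ∧
      ∀ i, U * S' i * Uᴴ =
        Matrix.fromBlocks (S i ⊗ₖ (1 : Matrix (Fin d₁) (Fin d₁) ℂ)) 0 0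
          ((S i).map (starRingEnd ℂ) ⊗ₖ (1 : Matrix (Fin d₂) (Fin d₂) ℂ))

/-- `U Π'ᵢ U† = Πᵢ ⊗ 1^{D/d}` for all `i` and one unitary `U`. -/
def EquivUnitary {d D n : ℕ} (S : Fin n → Matrix (Fin d) (Fin d) ℂ)
    (S' : Fin n → Matrix (Fin D) (Fin D) ℂ) : Prop :=
  ∃ k : ℕ, D = d * k ∧
    ∃ U : Matrix (Fin d × Fin k) (Fin D) ℂ,
      U * Uᴴ = 1 ∧ Uᴴ * U = 1 ∧
      ∀ i, U * S' i * Uᴴ = S i ⊗ₖ (1 : Matrix (Fin k) (Fin k) ℂ)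

/-- All the matrices of the family have real entries. -/
def IsRealFamily {d n : ℕ} (S : Fin n → Matrix (Fin d) (Fin d) ℂ) : Prop :=
  ∀ i a b, (S i a b).im = 0

end CFR

end

/-!
The family `S` consists of the projectors onto the thirteen Yu–Oh rays `e i`, `e i ± e j`,
`e i ± e j ± e k` of every triple of coordinates of `ℂ^d`; it is real in every dimension `d ≥ 3`.
Within a triple these projectors satisfy eight linear relations `∑ i, c k i • P i = b k • 1`
(`yuOhCoeff`; the basis vectors outside the triple complete the identity).

The relations are chosen so that their squares, added up, contain no product `P i * P j` of
projectors onto non-orthogonal rays (`sum_yuOhCoeff_mul_eq_zero`). Hence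
`∑ k, (b k) ^ 2 - ∑ k, (∑ i, c k i • P i - b k • 1) ^ 2` is, for projectors that commute along the
edges of the graph of compatibility, a functional `𝒲` of the required form, and raising its edge
weights only subtracts nonnegative multiples of the projectors `P i * P j`
(`sosWitness_value_eq`). So `Q = ∑ k, (b k) ^ 2` bounds `𝒲` in all quantum realizations, the
family `S` attains it in every state, and a realization that attains it in a state of full rank
satisfies all the relations, with `P i * P j = 0` along every edge (`relations_of_value_eq`).

These relations are rigid (`equivUnitary_of_relations`). The projector onto `e i + e j` differs from
the mean of those onto `e i` and `e j` by an element `x` whose square is a quarter of `P i + P j`.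
The projectors onto the four rays `(1, ±1, ±1)` of a triple are affine in the three elements of
this kind, and their idempotency says that each of these elements is twice the anticommutator of
the other two (`anticommutator_of_isIdempotentElem`). This kills the diagonal blocks
and makes the off-diagonal blocks a system of matrix units (`RayRealization.isMatrixUnits`), from
which the projectors arise with the same coefficients as in `S`; an orthonormal basis of the range
of one diagonal matrix unit then gives the unitary (`IsMatrixUnits.equivUnitary`).

The noncontextual maximum is the weighted independence number, because the functional is an average
over deterministic models and because dropping an end of an edge from a set of indices never lowers
the value (`Witness.detValue_le`). An independent set is a quantum realization in dimension one, so
that the maximum is at most `Q`, and it is not `Q` since rigidity would make `d` divide `1`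
(`weightedIndepNum_lt`).
-/

namespace CFR

/-! ### Noncontextual values and independent sets -/

section Noncontextual

variable {n : ℕ} (W : Witness n)

open Classical in
/-- The value of the functional in the deterministic model in which exactly the observables in `s`
have outcome `1`. -/
noncomputable def Witness.detValue (s : Finset (Fin n)) : ℝ :=
  W.eval (fun i => if i ∈ s then 1 else 0) (fun i j => if i ∈ s ∧ j ∈ s then 1 else 0)

open Classical in
theorem Witness.detValue_eq (s : Finset (Fin n)) :
    W.detValue s = ∑ i ∈ s, W.w i -
      ∑ i, ∑ j, if i < j ∧ W.graph.Adj i j ∧ i ∈ s ∧ j ∈ s then W.wE i j else 0 := by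
  simp only [Witness.detValue, Witness.eval]
  congr 1
  · simp
  · refine Finset.sum_congr rfl fun i _ => Finset.sum_congr rfl fun j _ => ?_
    split_ifs <;> simp_all

theorem Witness.wE_pos {i j : Fin n} (h : W.graph.Adj i j) : 0 < W.wE i j :=
  (W.w_pos i).trans_le ((le_max_left _ _).trans (W.le_wE i j h))

theorem Witness.detValue_of_isIndepSet {s : Finset (Fin n)}
    (hs : W.graph.IsIndepSet (s : Set (Fin n))) : W.detValue s = ∑ i ∈ s, W.w i := by
  classical
  rw [W.detValue_eq, sub_eq_self]
  refine Finset.sum_eq_zero fun i _ => Finset.sum_eq_zero fun j _ => if_neg ?_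
  rintro ⟨hij, hadj, hi, hj⟩
  exact hs (by simpa using hi) (by simpa using hj) hij.ne hadj

theorem finite_indepWeights (G : SimpleGraph (Fin n)) (w : Fin n → ℝ) :
    {x : ℝ | ∃ s : Finset (Fin n), G.IsIndepSet (s : Set (Fin n)) ∧ x = ∑ i ∈ s, w i}.Finite := by
  refine (Set.finite_range fun s : Finset (Fin n) => ∑ i ∈ s, w i).subset ?_
  rintro x ⟨s, -, rfl⟩
  exact ⟨s, rfl⟩

theorem exists_isIndepSet_weight_eq (G : SimpleGraph (Fin n)) (w : Fin n → ℝ) :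
    ∃ s : Finset (Fin n), G.IsIndepSet (s : Set (Fin n)) ∧
      weightedIndepNum G w = ∑ i ∈ s, w i :=
  Set.Nonempty.csSup_mem (s := {x : ℝ | ∃ s : Finset (Fin n),
      G.IsIndepSet (s : Set (Fin n)) ∧ x = ∑ i ∈ s, w i})
    ⟨0, ∅, by simp [SimpleGraph.IsIndepSet], by simp⟩ (finite_indepWeights G w)

/-- Dropping one end `i` of an edge inside `s` costs the weight of `i` and saves the weight of the
edge, which is at least as large; hence independent sets are optimal among all sets. -/
theorem Witness.detValue_le (s : Finset (Fin n)) :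
    W.detValue s ≤ weightedIndepNum W.graph W.w := by
  classical
  induction s using Finset.strongInduction with
  | H s ih =>
    by_cases hs : W.graph.IsIndepSet (s : Set (Fin n))
    · rw [W.detValue_of_isIndepSet hs]
      exact le_csSup (finite_indepWeights _ _).bddAbove ⟨s, hs, rfl⟩
    · obtain ⟨a, ha, b, hb, hab⟩ : ∃ a ∈ s, ∃ b ∈ s, a < b ∧ W.graph.Adj a b := by
        simp only [SimpleGraph.IsIndepSet, Set.Pairwise, Finset.mem_coe, not_forall,
          not_not] at hs
        obtain ⟨a, ha, b, hb, hne, hadj⟩ := hs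
        rcases lt_or_gt_of_ne hne with h | h
        · exact ⟨a, ha, b, hb, h, hadj⟩
        · exact ⟨b, hb, a, ha, h, hadj.symm⟩
      refine le_trans ?_ (ih _ (Finset.erase_ssubset ha))
      rw [W.detValue_eq, W.detValue_eq, ← Finset.add_sum_erase s W.w ha]
      have hE : (∑ i, ∑ j, if i < j ∧ W.graph.Adj i j ∧ i ∈ s.erase a ∧ j ∈ s.erase a
            then W.wE i j else 0) + (∑ i, ∑ j, if i = a ∧ j = b then W.wE a b else 0) ≤
          ∑ i, ∑ j, if i < j ∧ W.graph.Adj i j ∧ i ∈ s ∧ j ∈ s then W.wE i j else 0 := by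
        rw [← Finset.sum_add_distrib]
        refine Finset.sum_le_sum fun i _ => ?_
        rw [← Finset.sum_add_distrib]
        refine Finset.sum_le_sum fun j _ => ?_
        by_cases h1 : i = a ∧ j = b
        · obtain ⟨rfl, rfl⟩ := h1
          simp [ha, hb, hab]
        · rw [if_neg h1, add_zero]
          by_cases h2 : i < j ∧ W.graph.Adj i j ∧ i ∈ s ∧ j ∈ s
          · rw [if_pos h2]
            split_ifs
            · exact le_rfl
            · exact (W.wE_pos h2.2.1).le
          · rw [if_neg h2, if_neg]
            rintro ⟨h3, h4, h5, h6⟩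
            exact h2 ⟨h3, h4, Finset.mem_of_mem_erase h5, Finset.mem_of_mem_erase h6⟩
      have hab' : (∑ i, ∑ j, if i = a ∧ j = b then W.wE a b else 0) = W.wE a b := by
        simp [ite_and]
      have := (le_max_left _ _).trans (W.le_wE a b hab.2)
      linarith

/-- The functional is the expectation of its value in the deterministic models. -/
theorem Witness.eval_measure_eq_integral {Λ : Type} [MeasurableSpace Λ]
    (μ : MeasureTheory.Measure Λ) [MeasureTheory.IsProbabilityMeasure μ] (A : Fin n → Set Λ)
    (hA : ∀ i, MeasurableSet (A i)) :
    ∃ s : Λ → Finset (Fin n), MeasureTheory.Integrable (fun x => W.detValue (s x)) μ ∧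
      W.eval (fun i => μ.real (A i)) (fun i j => μ.real (A i ∩ A j)) =
        ∫ x, W.detValue (s x) ∂μ := by
  classical
  have h1 : ∀ i, MeasureTheory.Integrable (fun x => W.w i * (A i).indicator 1 x) μ := fun i =>
    ((MeasureTheory.integrable_const (1 : ℝ)).indicator (hA i)).const_mul _
  have h2 : ∀ i j, MeasureTheory.Integrable (fun x => if i < j ∧ W.graph.Adj i j then
      W.wE i j * (A i ∩ A j).indicator 1 x else 0) μ := by
    intro i j
    split_ifs
    · exact ((MeasureTheory.integrable_const (1 : ℝ)).indicator ((hA i).inter (hA j))).const_mul _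
    · exact MeasureTheory.integrable_const _
  have h1' := MeasureTheory.integrable_finsetSum (μ := μ) Finset.univ fun i _ => h1 i
  have h2' := MeasureTheory.integrable_finsetSum (μ := μ) Finset.univ fun i _ =>
    MeasureTheory.integrable_finsetSum (μ := μ) Finset.univ fun j _ => h2 i j
  have key : ∀ x, W.detValue (Finset.univ.filter fun i => x ∈ A i) =
      ∑ i, W.w i * (A i).indicator 1 x - ∑ i, ∑ j, if i < j ∧ W.graph.Adj i j then
        W.wE i j * (A i ∩ A j).indicator 1 x else 0 := by
    intro x
    simp [Witness.detValue, Witness.eval, Set.indicator_apply]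
  refine ⟨fun x => Finset.univ.filter fun i => x ∈ A i, ?_, ?_⟩
  · simp only [key]
    exact h1'.sub h2'
  · simp only [key]
    rw [MeasureTheory.integral_sub h1' h2', MeasureTheory.integral_finsetSum _ fun i _ => h1 i,
      MeasureTheory.integral_finsetSum _ fun i _ =>
        MeasureTheory.integrable_finsetSum (μ := μ) Finset.univ fun j _ => h2 i j]
    simp only [Witness.eval]
    congr 1
    · refine Finset.sum_congr rfl fun i _ => ?_
      rw [MeasureTheory.integral_const_mul, MeasureTheory.integral_indicator_one (hA i)]
    · refine Finset.sum_congr rfl fun i _ => ?_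
      rw [MeasureTheory.integral_finsetSum _ fun j _ => h2 i j]
      refine Finset.sum_congr rfl fun j _ => ?_
      split_ifs
      · rw [MeasureTheory.integral_const_mul,
          MeasureTheory.integral_indicator_one ((hA i).inter (hA j))]
      · simp

theorem Witness.isGreatest_nchvValues :
    IsGreatest W.nchvValues (weightedIndepNum W.graph W.w) := by
  classical
  constructor
  · obtain ⟨s, hs, h⟩ := exists_isIndepSet_weight_eq W.graph W.w
    refine ⟨Unit, inferInstance, MeasureTheory.Measure.dirac (), fun i => {_x | i ∈ s},
      inferInstance, fun i => MeasurableSet.const _, ?_⟩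
    rw [h, ← W.detValue_of_isIndepSet hs, Witness.detValue]
    congr 1
    · funext i
      by_cases hi : i ∈ s <;> simp [hi]
    · funext i j
      by_cases hi : i ∈ s <;> by_cases hj : j ∈ s <;> simp [hi, hj]
  · rintro x ⟨Λ, _, μ, A, hμ, hA, rfl⟩
    obtain ⟨s, hint, h⟩ := W.eval_measure_eq_integral μ A hA
    rw [h]
    calc ∫ x, W.detValue (s x) ∂μ ≤ ∫ _x, weightedIndepNum W.graph W.w ∂μ :=
          MeasureTheory.integral_mono hint (MeasureTheory.integrable_const _)
            fun x => W.detValue_le _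
      _ = _ := by simp

end Noncontextual

/-! ### Families of projectors from matrix units -/

/-- An orthonormal basis of the range of a projector, as the columns of a matrix. -/
theorem exists_isometry_of_isStarProjection {D : ℕ} {P : Matrix (Fin D) (Fin D) ℂ}
    (hP : IsStarProjection P) :
    ∃ (k : ℕ) (F : Matrix (Fin D) (Fin k) ℂ), Fᴴ * F = 1 ∧ F * Fᴴ = P := by
  classical
  obtain ⟨V, ev, hVV, hVV', hspec⟩ : ∃ (V : Matrix (Fin D) (Fin D) ℂ) (ev : Fin D → ℝ),
      Vᴴ * V = 1 ∧ V * Vᴴ = 1 ∧ P = V * Matrix.diagonal (fun i => (ev i : ℂ)) * Vᴴ := by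
    have hH : P.IsHermitian := hP.isSelfAdjoint
    refine ⟨↑hH.eigenvectorUnitary, hH.eigenvalues, Unitary.coe_star_mul_self _,
      Unitary.coe_mul_star_self _, ?_⟩
    have := hH.spectral_theorem
    rw [Unitary.conjStarAlgAut_apply] at this
    exact this
  have hdiag : Matrix.diagonal (fun i => (ev i : ℂ)) = Vᴴ * P * V := by
    rw [hspec]
    simp only [Matrix.mul_assoc, hVV, Matrix.mul_one]
    rw [← Matrix.mul_assoc, hVV, Matrix.one_mul]
  have hev : ∀ i, ev i = 0 ∨ ev i = 1 := by
    intro i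
    have h2 : Matrix.diagonal (fun i => (ev i : ℂ)) *
        Matrix.diagonal (fun i => (ev i : ℂ)) =
        Matrix.diagonal (fun i => (ev i : ℂ)) := by
      rw [hdiag]
      calc Vᴴ * P * V * (Vᴴ * P * V) = Vᴴ * P * (V * Vᴴ) * P * V := by
            simp only [Matrix.mul_assoc]
        _ = Vᴴ * (P * P) * V := by rw [hVV', Matrix.mul_one, Matrix.mul_assoc Vᴴ]
        _ = _ := by rw [hP.isIdempotentElem.eq]
    rw [Matrix.diagonal_mul_diagonal] at h2
    have h3 := congrFun (Matrix.diagonal_injective h2) i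
    have h4 : ev i * ev i = ev i := by exact_mod_cast h3
    rcases eq_or_ne (ev i) 0 with h | h
    · exact Or.inl h
    · exact Or.inr (mul_left_cancel₀ h (by rw [h4, mul_one]))
  let ι := {i // ev i = 1}
  let e : Fin (Fintype.card ι) ≃ ι := (Fintype.equivFin ι).symm
  refine ⟨Fintype.card ι, V.submatrix id (fun a => (e a : Fin D)), ?_, ?_⟩
  · ext a b
    have := congrFun (congrFun hVV (e a)) (e b)
    simp only [Matrix.mul_apply, Matrix.conjTranspose_apply, Matrix.submatrix_apply, id,
      Matrix.one_apply] at this ⊢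
    rw [this]
    simp [Subtype.ext_iff.symm]
  · ext a b
    conv_rhs => rw [hspec]
    simp only [Matrix.mul_apply, Matrix.conjTranspose_apply, Matrix.submatrix_apply, id,
      Matrix.diagonal_apply, mul_ite, mul_zero, Finset.sum_ite_eq', Finset.mem_univ, if_true]
    rw [Equiv.sum_comp e (fun x : ι => V a x * star (V b x))]
    refine Fintype.sum_of_injective (fun x : ι => (x : Fin D)) Subtype.val_injective _ _ ?_ ?_
    · intro i hi
      rcases hev i with h | h
      · simp [h]
      · exact absurd ⟨⟨i, h⟩, rfl⟩ hi
    · intro x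
      simp [x.2]

theorem EquivUnitary.equivUpToConj {d D n : ℕ} {S : Fin n → Matrix (Fin d) (Fin d) ℂ}
    {S' : Fin n → Matrix (Fin D) (Fin D) ℂ} (h : EquivUnitary S S') : EquivUpToConj S S' := by
  obtain ⟨k, hk, U, h1, h2, h3⟩ := h
  refine ⟨k, 0, by simpa using hk, Matrix.fromRows U 0, ?_, ?_, fun i => ?_⟩
  · rw [Matrix.conjTranspose_fromRows_eq_fromCols_conjTranspose, Matrix.fromRows_mul_fromCols, h1]
    ext (a | a) (b | b)
    · simp [Matrix.one_apply]
    all_goals first | exact a.2.elim0 | exact b.2.elim0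
  · rw [Matrix.conjTranspose_fromRows_eq_fromCols_conjTranspose, Matrix.fromCols_mul_fromRows, h2]
    simp
  · rw [Matrix.conjTranspose_fromRows_eq_fromCols_conjTranspose, Matrix.fromRows_mul,
      Matrix.fromRows_mul_fromCols, h3]
    ext (a | a) (b | b)
    · simp
    all_goals first | exact a.2.elim0 | exact b.2.elim0

/-- A system of `d × d` matrix units in the matrices of size `D`, compatible with the adjoint. -/
structure IsMatrixUnits {d D : ℕ} (E : Fin d → Fin d → Matrix (Fin D) (Fin D) ℂ) : Prop where
  mul_same : ∀ i j k, E i j * E j k = E i k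
  mul_of_ne : ∀ i j k l, j ≠ k → E i j * E k l = 0
  sum_diag : ∑ i, E i i = 1
  conjTranspose : ∀ i j, (E i j)ᴴ = E j i

/-- A family whose members are the same linear combinations of the standard matrix units
and of a system of matrix units is a multiple of the first family: if `F` is an isometry onto the
range of `E a₀ a₀`, the vectors `E i a₀ (F x)` form the adapted orthonormal basis. -/
theorem IsMatrixUnits.equivUnitary {d D n : ℕ} (a₀ : Fin d)
    {E : Fin d → Fin d → Matrix (Fin D) (Fin D) ℂ} (hE : IsMatrixUnits E)
    {S : Fin n → Matrix (Fin d) (Fin d) ℂ} {S' : Fin n → Matrix (Fin D) (Fin D) ℂ}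
    (hS : ∀ v, S' v = ∑ i, ∑ j, S v i j • E i j) : EquivUnitary S S' := by
  have hproj : IsStarProjection (E a₀ a₀) :=
    ⟨hE.mul_same a₀ a₀ a₀, hE.conjTranspose a₀ a₀⟩
  obtain ⟨k, F, hF1, hF2⟩ := exists_isometry_of_isStarProjection hproj
  let U : Matrix (Fin d × Fin k) (Fin D) ℂ := Matrix.of fun p => (Fᴴ * E a₀ p.1) p.2
  have hUconj : ∀ (i j : Fin d) (x y : Fin k) (M : Matrix (Fin D) (Fin D) ℂ),
      (U * M * Uᴴ) (i, x) (j, y) = (Fᴴ * (E a₀ i * M * E j a₀) * F) x y := by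
    intro i j x y M
    have : (U * M * Uᴴ) (i, x) (j, y) = ((Fᴴ * E a₀ i) * M * (Fᴴ * E a₀ j)ᴴ) x y := rfl
    rw [this, Matrix.conjTranspose_mul, Matrix.conjTranspose_conjTranspose, hE.conjTranspose]
    simp only [Matrix.mul_assoc]
  have hF3 : Fᴴ * E a₀ a₀ * F = 1 := by
    rw [← hF2, ← Matrix.mul_assoc, hF1, Matrix.one_mul, hF1]
  have hunit : ∀ i j, U * E i j * Uᴴ =
      Matrix.single i j (1 : ℂ) ⊗ₖ (1 : Matrix (Fin k) (Fin k) ℂ) := by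
    intro i j
    ext ⟨a, x⟩ ⟨b, y⟩
    rw [hUconj]
    by_cases hai : a = i
    · subst hai
      by_cases hbj : b = j
      · subst hbj
        rw [hE.mul_same, hE.mul_same, hF3]
        simp [Matrix.kroneckerMap_apply]
      · rw [hE.mul_same, hE.mul_of_ne _ _ _ _ (Ne.symm hbj)]
        simp [Matrix.kroneckerMap_apply, Ne.symm hbj]
    · rw [hE.mul_of_ne _ _ _ _ hai]
      simp [Matrix.kroneckerMap_apply, Ne.symm hai]
  have hU1 : U * Uᴴ = 1 := by
    have : U * Uᴴ = U * (∑ i, E i i) * Uᴴ := by rw [hE.sum_diag, Matrix.mul_one]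
    rw [this, Matrix.mul_sum, Matrix.sum_mul]
    simp only [hunit]
    ext ⟨a, x⟩ ⟨b, y⟩
    simp only [Matrix.sum_apply, Matrix.kroneckerMap_apply, Matrix.single_apply, Matrix.one_apply,
      Prod.mk.injEq]
    by_cases hab : a = b
    · subst hab
      simp
    · have : ∀ i, ¬(i = a ∧ i = b) := fun i h => hab (h.1.symm.trans h.2)
      simp [this, hab]
  have hU2 : Uᴴ * U = 1 := by
    have : Uᴴ * U = ∑ i, (Fᴴ * E a₀ i)ᴴ * (Fᴴ * E a₀ i) := by
      ext a b
      simp only [Matrix.mul_apply, Matrix.sum_apply, Fintype.sum_prod_type]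
      rfl
    rw [this, ← hE.sum_diag]
    refine Finset.sum_congr rfl fun i _ => ?_
    rw [Matrix.conjTranspose_mul, Matrix.conjTranspose_conjTranspose, hE.conjTranspose]
    calc E i a₀ * F * (Fᴴ * E a₀ i) = E i a₀ * (F * Fᴴ) * E a₀ i := by
          simp only [Matrix.mul_assoc]
      _ = E i i := by rw [hF2, hE.mul_same, hE.mul_same]
  refine ⟨k, ?_, U, hU1, hU2, fun v => ?_⟩
  · have := Matrix.square_of_invertible U Uᴴ hU1 hU2
    simpa using this.symm
  · rw [hS]
    simp only [Matrix.mul_sum, Matrix.sum_mul, Matrix.mul_smul, Matrix.smul_mul, hunit]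
    ext ⟨a, x⟩ ⟨b, y⟩
    simp [Matrix.sum_apply, Matrix.kroneckerMap_apply, Matrix.single_apply, ite_and]

/-! ### Expectation values -/

section Expectation

variable {D : ℕ}

/-- The expectation value of an observable in the state `ρ`, as a real linear functional. -/
noncomputable def expect (ρ : Matrix (Fin D) (Fin D) ℂ) : Matrix (Fin D) (Fin D) ℂ →ₗ[ℝ] ℝ :=
  Complex.reLm ∘ₗ (Matrix.traceLinearMap (Fin D) ℂ ℂ).restrictScalars ℝ ∘ₗ LinearMap.mulLeft ℝ ρ

theorem expect_apply (ρ M : Matrix (Fin D) (Fin D) ℂ) : expect ρ M = (ρ * M).trace.re := rfl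

theorem expect_one {ρ : Matrix (Fin D) (Fin D) ℂ} (hρ : IsState ρ) : expect ρ 1 = 1 := by
  rw [expect_apply, Matrix.mul_one, hρ.2, Complex.one_re]

theorem expect_sq_eq {ρ R : Matrix (Fin D) (Fin D) ℂ} (hR : Rᴴ = R) :
    expect ρ (R * R) = (Rᴴ * ρ * R).trace.re := by
  rw [expect_apply, Matrix.mul_assoc Rᴴ, Matrix.trace_mul_comm Rᴴ, hR, Matrix.mul_assoc]

theorem expect_sq_nonneg {ρ R : Matrix (Fin D) (Fin D) ℂ} (hρ : ρ.PosSemidef) (hR : Rᴴ = R) :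
    0 ≤ expect ρ (R * R) := by
  rw [expect_sq_eq hR]
  exact (Complex.le_def.1 (hρ.conjTranspose_mul_mul_same R).trace_nonneg).1

/-- A state of full rank is faithful. -/
theorem eq_zero_of_expect_sq {ρ R : Matrix (Fin D) (Fin D) ℂ} (hρ : ρ.PosDef) (hR : Rᴴ = R)
    (h : expect ρ (R * R) = 0) : R = 0 := by
  have hps := hρ.posSemidef.conjTranspose_mul_mul_same R
  have htr : (Rᴴ * ρ * R).trace = 0 := by
    rw [expect_sq_eq hR] at h
    exact Complex.ext h (Complex.le_def.1 hps.trace_nonneg).2.symm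
  have hz : Rᴴ * ρ * R = 0 := hps.trace_eq_zero_iff.1 htr
  refine Matrix.ext_of_mulVec_single fun i => ?_
  by_contra hne
  rw [Matrix.zero_mulVec] at hne
  have hpos := hρ.dotProduct_mulVec_pos hne
  rw [Matrix.star_mulVec, ← Matrix.dotProduct_mulVec, Matrix.mulVec_mulVec, Matrix.mulVec_mulVec,
    hz] at hpos
  simp at hpos

theorem posDef_of_rank_eq {ρ : Matrix (Fin D) (Fin D) ℂ} (hρ : ρ.PosSemidef) (hr : ρ.rank = D) :
    ρ.PosDef := by
  refine hρ.posDef_iff_isUnit.2 ?_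
  rw [← Matrix.mulVec_surjective_iff_isUnit]
  have : LinearMap.range ρ.mulVecLin = ⊤ :=
    Submodule.eq_top_of_finrank_eq (by rw [Module.finrank_fin_fun]; exact hr)
  exact LinearMap.range_eq_top.1 this

theorem IsStarProjection.mul_sq {P R : Matrix (Fin D) (Fin D) ℂ} (hP : IsStarProjection P)
    (hR : IsStarProjection R) (h : Commute P R) :
    (P * R)ᴴ = P * R ∧ (P * R) * (P * R) = P * R := by
  constructor
  · rw [Matrix.conjTranspose_mul]
    have h1 : Pᴴ = P := hP.isSelfAdjoint
    have h2 : Rᴴ = R := hR.isSelfAdjoint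
    rw [h1, h2, h.eq]
  · calc P * R * (P * R) = P * (R * P) * R := by simp only [Matrix.mul_assoc]
      _ = (P * P) * (R * R) := by rw [← h.eq]; simp only [Matrix.mul_assoc]
      _ = P * R := by rw [hP.isIdempotentElem.eq, hR.isIdempotentElem.eq]

end Expectation

theorem conjTranspose_relation {n D : ℕ} {P : Fin n → Matrix (Fin D) (Fin D) ℂ}
    (hP : ∀ i, IsStarProjection (P i)) (a : Fin n → ℝ) (β : ℝ) :
    (∑ i, a i • P i - β • 1)ᴴ = ∑ i, a i • P i - β • (1 : Matrix (Fin D) (Fin D) ℂ) := by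
  have h : ∀ i, (P i)ᴴ = P i := fun i => (hP i).isSelfAdjoint
  simp [Matrix.conjTranspose_sub, Matrix.conjTranspose_sum, Matrix.conjTranspose_smul, h]

/-! ### Witnesses from sums of squares of linear relations -/

section SumOfSquares

variable {n : ℕ} {K : Type} [Fintype K] (c : K → Fin n → ℝ) (b : K → ℝ)

/-- The real linear relations `∑ i, c k i • P i = b k • 1`, one for each `k`. -/
def LinearRelations {D : ℕ} (P : Fin n → Matrix (Fin D) (Fin D) ℂ) : Prop :=
  ∀ k, ∑ i, c k i • P i = b k • 1

/-- The coefficient of `P i * P j` in the sum of the squares of the relations. -/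
def gram (i j : Fin n) : ℝ := ∑ k, c k i * c k j

/-- Minus the coefficient of `P i` in `∑ k, (∑ i, c k i • P i - b k • 1) ^ 2`, where
`P i ^ 2 = P i` is used. -/
def sosWeight (i : Fin n) : ℝ := ∑ k, (2 * b k * c k i - c k i ^ 2)

/-- The functional obtained from the sum of the squares of the relations. The edge weights
exceed those of the sum of squares, so that the bound `∑ k, b k ^ 2` is attained only if the
observables at the ends of each edge are orthogonal. -/
noncomputable def sosWitness (G : SimpleGraph (Fin n)) (hw : ∀ i, 0 < sosWeight c b i) :
    Witness n where
  graph := G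
  w := sosWeight c b
  wE i j := max (sosWeight c b i) (sosWeight c b j) + 2 * |gram c i j| + 1
  w_pos := hw
  wE_symm i j := by rw [max_comm]; simp only [gram, mul_comm]
  le_wE i j _ := by linarith [abs_nonneg (gram c i j)]

variable {c b}

theorem sosWitness_wE_gt {G : SimpleGraph (Fin n)} (hw : ∀ i, 0 < sosWeight c b i) (i j : Fin n) :
    0 < (sosWitness c b G hw).wE i j - 2 * gram c i j := by
  have h1 := hw i
  have h2 := le_max_left (sosWeight c b i) (sosWeight c b j)
  have h3 := le_abs_self (gram c i j)
  simp only [sosWitness]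
  linarith

theorem sum_sum_eq_diag_add {F : Fin n → Fin n → ℝ} (hF : ∀ i j, F i j = F j i) :
    ∑ i, ∑ j, F i j = ∑ i, F i i + 2 * ∑ i, ∑ j, if i < j then F i j else 0 := by
  have h1 : ∀ i j, F i j = (if i = j then F i j else 0) + (if i < j then F i j else 0) +
      (if j < i then F j i else 0) := by
    intro i j
    rcases lt_trichotomy i j with h | h | h
    · simp [h, h.ne, h.not_gt]
    · simp [h]
    · simp [h, h.ne', h.not_gt, hF i j]
  calc ∑ i, ∑ j, F i j = ∑ i, ∑ j, ((if i = j then F i j else 0) + (if i < j then F i j else 0) +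
      (if j < i then F j i else 0)) :=
        Finset.sum_congr rfl fun i _ => Finset.sum_congr rfl fun j _ => h1 i j
    _ = _ := by
        simp only [Finset.sum_add_distrib]
        rw [Finset.sum_comm (f := fun i j => if j < i then F j i else 0)]
        simp only [Finset.sum_ite_eq, Finset.mem_univ, if_true]
        ring

/-- The sum-of-squares identity. The Gram matrix must vanish at distinct non-adjacent indices,
because the products of the corresponding observables do not occur in the functional. -/
theorem sosWitness_value_eq {G : SimpleGraph (Fin n)} (hw : ∀ i, 0 < sosWeight c b i)
    (hG : ∀ i j, i ≠ j → ¬ G.Adj i j → gram c i j = 0) {D : ℕ}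
    {P : Fin n → Matrix (Fin D) (Fin D) ℂ} {ρ : Matrix (Fin D) (Fin D) ℂ}
    (hP : (sosWitness c b G hw).IsRealization P) (hρ : IsState ρ) :
    open Classical in
    ∑ k, b k ^ 2 - (sosWitness c b G hw).value P ρ =
      ∑ k, expect ρ ((∑ i, c k i • P i - b k • 1) * (∑ i, c k i • P i - b k • 1)) +
      ∑ i, ∑ j, if i < j ∧ G.Adj i j then
        ((sosWitness c b G hw).wE i j - 2 * gram c i j) * expect ρ (P i * P j) else 0 := by
  classical
  set x : Fin n → Fin n → ℝ := fun i j => expect ρ (P i * P j) with hx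
  have hsq : ∀ k, expect ρ ((∑ i, c k i • P i - b k • 1) * (∑ i, c k i • P i - b k • 1)) =
      ∑ i, ∑ j, c k i * c k j * x i j - ∑ i, 2 * b k * c k i * x i i + b k ^ 2 := by
    intro k
    have hxi : ∀ i, expect ρ (P i * P i) = expect ρ (P i) := fun i => by
      rw [(hP.1 i).isIdempotentElem.eq]
    simp only [sub_mul, mul_sub, Finset.sum_mul_sum, smul_mul_smul_comm, map_sub, map_sum, map_smul,
      Matrix.smul_mul, Matrix.mul_smul, Matrix.one_mul, Matrix.mul_one, expect_one hρ, smul_eq_mul,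
      hxi, hx]
    have e1 : b k * ∑ i, c k i * expect ρ (P i) = ∑ i, b k * c k i * expect ρ (P i) := by
      rw [Finset.mul_sum]; exact Finset.sum_congr rfl fun i _ => by ring
    have e2 : ∑ i, 2 * b k * c k i * expect ρ (P i) = 2 * ∑ i, b k * c k i * expect ρ (P i) := by
      rw [Finset.mul_sum]; exact Finset.sum_congr rfl fun i _ => by ring
    rw [e1, e2]
    ring
  have hsum : ∑ k, ∑ i, ∑ j, c k i * c k j * x i j = ∑ i, ∑ j, gram c i j * x i j := by
    rw [Finset.sum_comm]
    refine Finset.sum_congr rfl fun i _ => ?_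
    rw [Finset.sum_comm]
    refine Finset.sum_congr rfl fun j _ => ?_
    rw [gram, Finset.sum_mul]
  have hsymm : ∀ i j, gram c i j * x i j = gram c j i * x j i := by
    intro i j
    have hg : gram c j i = gram c i j := by simp only [gram, mul_comm]
    rw [hg]
    by_cases hij : i = j
    · rw [hij]
    · by_cases hadj : G.Adj i j
      · simp only [hx, (hP.2 i j hadj).eq]
      · rw [hG i j hij hadj, zero_mul, zero_mul]
  have hoff : (∑ i, ∑ j, if i < j then gram c i j * x i j else 0) =
      ∑ i, ∑ j, if i < j ∧ G.Adj i j then gram c i j * x i j else 0 := by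
    refine Finset.sum_congr rfl fun i _ => Finset.sum_congr rfl fun j _ => ?_
    by_cases hij : i < j
    · by_cases hadj : G.Adj i j
      · simp [hij, hadj]
      · simp [hadj, hG i j hij.ne hadj]
    · simp [hij]
  have hval : (sosWitness c b G hw).value P ρ = ∑ i, sosWeight c b i * x i i -
      ∑ i, ∑ j, if i < j ∧ G.Adj i j then (sosWitness c b G hw).wE i j * x i j else 0 := by
    simp only [Witness.value, Witness.eval, prob, jointProb, ← expect_apply]
    congr 1
    refine Finset.sum_congr rfl fun i _ => ?_
    simp only [hx, (hP.1 i).isIdempotentElem.eq]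
    rfl
  have hdiag : ∑ i, sosWeight c b i * x i i =
      ∑ k, ∑ i, 2 * b k * c k i * x i i - ∑ i, gram c i i * x i i := by
    rw [Finset.sum_comm, ← Finset.sum_sub_distrib]
    refine Finset.sum_congr rfl fun i _ => ?_
    rw [sosWeight, gram, ← Finset.sum_mul, ← sub_mul, ← Finset.sum_sub_distrib]
    simp only [pow_two]
  have hedge : (∑ i, ∑ j, if i < j ∧ G.Adj i j then
        ((sosWitness c b G hw).wE i j - 2 * gram c i j) * x i j else 0) =
      (∑ i, ∑ j, if i < j ∧ G.Adj i j then (sosWitness c b G hw).wE i j * x i j else 0) -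
      2 * ∑ i, ∑ j, if i < j ∧ G.Adj i j then gram c i j * x i j else 0 := by
    simp only [Finset.mul_sum, ← Finset.sum_sub_distrib]
    refine Finset.sum_congr rfl fun i _ => Finset.sum_congr rfl fun j _ => ?_
    split_ifs <;> ring
  simp only [hsq, Finset.sum_add_distrib, Finset.sum_sub_distrib]
  rw [hsum, sum_sum_eq_diag_add hsymm, hoff, hval, hdiag, hedge]
  ring

section Bound

variable {G : SimpleGraph (Fin n)} {hw : ∀ i, 0 < sosWeight c b i} {D : ℕ}
  {P : Fin n → Matrix (Fin D) (Fin D) ℂ} {ρ : Matrix (Fin D) (Fin D) ℂ}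

theorem expect_edge_nonneg (hP : (sosWitness c b G hw).IsRealization P) (hρ : ρ.PosSemidef)
    {i j : Fin n} (h : G.Adj i j) : 0 ≤ expect ρ (P i * P j) := by
  obtain ⟨h1, h2⟩ := IsStarProjection.mul_sq (hP.1 i) (hP.1 j) (hP.2 i j h)
  rw [← h2]
  exact expect_sq_nonneg hρ h1

theorem edgeTerm_nonneg (hP : (sosWitness c b G hw).IsRealization P) (hρ : ρ.PosSemidef)
    (i j : Fin n) : open Classical in 0 ≤ if i < j ∧ G.Adj i j then
      ((sosWitness c b G hw).wE i j - 2 * gram c i j) * expect ρ (P i * P j) else 0 := by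
  classical
  split_ifs with h
  · exact mul_nonneg (sosWitness_wE_gt hw i j).le (expect_edge_nonneg hP hρ h.2)
  · exact le_rfl

theorem sosWitness_value_le (hG : ∀ i j, i ≠ j → ¬ G.Adj i j → gram c i j = 0)
    (hP : (sosWitness c b G hw).IsRealization P) (hρ : IsState ρ) :
    (sosWitness c b G hw).value P ρ ≤ ∑ k, b k ^ 2 := by
  classical
  rw [← sub_nonneg, sosWitness_value_eq hw hG hP hρ]
  exact add_nonneg
    (Finset.sum_nonneg fun k _ => expect_sq_nonneg hρ.1 (conjTranspose_relation hP.1 (c k) (b k)))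
    (Finset.sum_nonneg fun i _ => Finset.sum_nonneg fun j _ => edgeTerm_nonneg hP hρ.1 i j)

/-- With a state of full rank, attaining the bound forces every square to vanish. -/
theorem relations_of_value_eq (hG : ∀ i j, i ≠ j → ¬ G.Adj i j → gram c i j = 0)
    (hP : (sosWitness c b G hw).IsRealization P) (hρ : IsState ρ) (hr : ρ.rank = D)
    (hQ : (sosWitness c b G hw).value P ρ = ∑ k, b k ^ 2) :
    LinearRelations c b P ∧ ∀ i j, G.Adj i j → P i * P j = 0 := by
  classical
  have hpd := posDef_of_rank_eq hρ.1 hr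
  have h0 := sosWitness_value_eq hw hG hP hρ
  rw [hQ, sub_self] at h0
  have hA : ∀ k ∈ Finset.univ, 0 ≤
      expect ρ ((∑ i, c k i • P i - b k • 1) * (∑ i, c k i • P i - b k • 1)) :=
    fun k _ => expect_sq_nonneg hρ.1 (conjTranspose_relation hP.1 (c k) (b k))
  have hB : ∀ i ∈ Finset.univ, 0 ≤ ∑ j, if i < j ∧ G.Adj i j then
      ((sosWitness c b G hw).wE i j - 2 * gram c i j) * expect ρ (P i * P j) else 0 :=
    fun i _ => Finset.sum_nonneg fun j _ => edgeTerm_nonneg hP hρ.1 i j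
  obtain ⟨hA0, hB0⟩ := (add_eq_zero_iff_of_nonneg (Finset.sum_nonneg hA)
    (Finset.sum_nonneg hB)).1 h0.symm
  have hlt : ∀ i j, i < j → G.Adj i j → P i * P j = 0 := by
    intro i j hij hadj
    have h1 := (Finset.sum_eq_zero_iff_of_nonneg hB).1 hB0 i (Finset.mem_univ i)
    have h2 := (Finset.sum_eq_zero_iff_of_nonneg
      fun j _ => edgeTerm_nonneg hP hρ.1 i j).1 h1 j (Finset.mem_univ j)
    rw [if_pos ⟨hij, hadj⟩] at h2
    obtain ⟨h3, h4⟩ := IsStarProjection.mul_sq (hP.1 i) (hP.1 j) (hP.2 i j hadj)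
    refine eq_zero_of_expect_sq hpd h3 ?_
    rw [h4]
    exact (mul_eq_zero.1 h2).resolve_left (sosWitness_wE_gt hw i j).ne'
  refine ⟨fun k => ?_, fun i j hadj => ?_⟩
  · exact sub_eq_zero.1 (eq_zero_of_expect_sq hpd (conjTranspose_relation hP.1 (c k) (b k))
      ((Finset.sum_eq_zero_iff_of_nonneg hA).1 hA0 k (Finset.mem_univ k)))
  · rcases lt_or_gt_of_ne hadj.ne with h | h
    · exact hlt i j h hadj
    · rw [(hP.2 i j hadj).eq]
      exact hlt j i h hadj.symm

theorem sosWitness_value_eq_of_relations (hG : ∀ i j, i ≠ j → ¬ G.Adj i j → gram c i j = 0)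
    (hP : ∀ i, IsStarProjection (P i)) (hrel : LinearRelations c b P)
    (horth : ∀ i j, G.Adj i j → P i * P j = 0) (hρ : IsState ρ) :
    (sosWitness c b G hw).value P ρ = ∑ k, b k ^ 2 := by
  classical
  have hreal : (sosWitness c b G hw).IsRealization P :=
    ⟨hP, fun i j h => (horth i j h).trans (horth j i h.symm).symm⟩
  have h := sosWitness_value_eq hw hG hreal hρ
  have h1 : ∀ k, ∑ i, c k i • P i - b k • (1 : Matrix (Fin D) (Fin D) ℂ) = 0 :=
    fun k => sub_eq_zero.2 (hrel k)
  have h2 : (∑ i, ∑ j, if i < j ∧ G.Adj i j then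
      ((sosWitness c b G hw).wE i j - 2 * gram c i j) * expect ρ (P i * P j) else 0) = 0 := by
    refine Finset.sum_eq_zero fun i _ => Finset.sum_eq_zero fun j _ => ?_
    split_ifs with hij
    · rw [horth i j hij.2, map_zero, mul_zero]
    · rfl
  rw [h2] at h
  simp only [h1, mul_zero, map_zero, Finset.sum_const_zero, add_zero] at h
  linarith

end Bound

/-- An independent set is a quantum realization in dimension one. -/
theorem Witness.exists_realization_one (W : Witness n) :
    ∃ (P : Fin n → Matrix (Fin 1) (Fin 1) ℂ), W.IsRealization P ∧
      W.value P 1 = weightedIndepNum W.graph W.w := by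
  classical
  obtain ⟨s, hs, h⟩ := exists_isIndepSet_weight_eq W.graph W.w
  refine ⟨fun i => if i ∈ s then 1 else 0, ⟨fun i => ?_, fun i j _ => ?_⟩, ?_⟩
  · dsimp only
    split_ifs
    · exact IsStarProjection.one _
    · exact IsStarProjection.zero _
  · dsimp only
    split_ifs <;> simp
  · rw [h, ← W.detValue_of_isIndepSet hs, Witness.detValue, Witness.value]
    congr 1
    · funext i
      by_cases hi : i ∈ s <;> simp [hi, prob]
    · funext i j
      by_cases hi : i ∈ s <;> by_cases hj : j ∈ s <;> simp [hi, hj, jointProb]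

theorem isState_one : IsState (1 : Matrix (Fin 1) (Fin 1) ℂ) :=
  ⟨Matrix.PosSemidef.one, by simp⟩

/-- If the relations and the orthogonality along the edges determine the family up to
multiplicity, the independent sets cannot attain the quantum value, since they are realizations
in dimension `1`. -/
theorem weightedIndepNum_lt {d : ℕ} (hd : 2 ≤ d) {S : Fin n → Matrix (Fin d) (Fin d) ℂ}
    {G : SimpleGraph (Fin n)} {hw : ∀ i, 0 < sosWeight c b i}
    (hG : ∀ i j, i ≠ j → ¬ G.Adj i j → gram c i j = 0)
    (hrigid : ∀ (D : ℕ) (P : Fin n → Matrix (Fin D) (Fin D) ℂ), (∀ i, IsStarProjection (P i)) →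
      LinearRelations c b P → (∀ i j, G.Adj i j → P i * P j = 0) → EquivUnitary S P) :
    weightedIndepNum G (sosWeight c b) < ∑ k, b k ^ 2 := by
  obtain ⟨P, hP, hval⟩ := (sosWitness c b G hw).exists_realization_one
  have hle := sosWitness_value_le hG hP isState_one
  refine lt_of_le_of_ne (hval ▸ hle) fun heq => ?_
  obtain ⟨h1, h2⟩ := relations_of_value_eq hG hP isState_one (by simp) (hval.trans heq)
  obtain ⟨k, hk, -⟩ := hrigid 1 P hP.1 h1 h2
  have := Nat.eq_one_of_mul_eq_one_right hk.symm
  omega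

end SumOfSquares

/-! ### The Yu–Oh rays and their relations -/

/-- The thirteen rays of Yu and Oh in dimension three. -/
def yuOh : Fin 13 → Fin 3 → ℤ :=
  ![![1, 0, 0], ![0, 1, 0], ![0, 0, 1], ![0, 1, 1], ![0, 1, -1], ![1, 0, 1], ![1, 0, -1],
    ![1, 1, 0], ![1, -1, 0], ![1, 1, 1], ![1, 1, -1], ![1, -1, 1], ![1, -1, -1]]

/-- The coefficients of eight linear relations between the projectors onto the Yu–Oh rays: four
between a ray of `(1, ±1, ±1)` and the three rays `e i ± e j` orthogonal to it, three that combine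
the planes spanned by pairs of basis vectors, and the completeness of the basis. They are chosen
so that the squares of the relations add up to an expression without products of projectors onto
non-orthogonal rays. -/
def yuOhCoeff : Fin 8 → Fin 13 → ℤ :=
  ![![0, 0, 0, 0, 2, 0, 2, 0, 2, 3, 0, 0, 0],
    ![0, 0, 0, 2, 0, 2, 0, 0, 2, 0, 3, 0, 0],
    ![0, 0, 0, 2, 0, 0, 2, 2, 0, 0, 0, 3, 0],
    ![0, 0, 0, 0, 2, 2, 0, 2, 0, 0, 0, 0, 3],
    ![4, 4, 0, 2, 2, 2, 2, -2, -2, 0, 0, 0, 0],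
    ![4, 0, 4, 2, 2, -2, -2, 2, 2, 0, 0, 0, 0],
    ![0, 4, 4, -2, -2, 2, 2, 2, 2, 0, 0, 0, 0],
    ![1, 1, 1, 0, 0, 0, 0, 0, 0, 0, 0, 0, 0]]

/-- The right-hand sides of the relations with coefficients `yuOhCoeff`. -/
def yuOhConst : Fin 8 → ℤ := ![3, 3, 3, 3, 4, 4, 4, 1]

/-- The Gram matrix of the relations vanishes at pairs of rays that are not orthogonal. -/
theorem sum_yuOhCoeff_mul_eq_zero : ∀ a b : Fin 13, a ≠ b → yuOh a ⬝ᵥ yuOh b ≠ 0 →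
    ∑ k, yuOhCoeff k a * yuOhCoeff k b = 0 := by
  decide

theorem yuOhWeight_pos :
    ∀ a, 0 < ∑ k, (2 * yuOhConst k * yuOhCoeff k a - yuOhCoeff k a ^ 2) := by
  decide

/-- The relations hold for the projectors onto the rays, here multiplied by `6`, the least common
multiple of the squared lengths. -/
theorem sum_yuOhCoeff_mul_entry : ∀ (k : Fin 8) (i j : Fin 3),
    ∑ a, yuOhCoeff k a * (6 / (yuOh a ⬝ᵥ yuOh a)) * (yuOh a i * yuOh a j) =
      6 * yuOhConst k * (1 : Matrix (Fin 3) (Fin 3) ℤ) i j := by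
  decide

theorem yuOh_dot_self_dvd : ∀ a, 6 / (yuOh a ⬝ᵥ yuOh a) * (yuOh a ⬝ᵥ yuOh a) = 6 := by
  decide

theorem yuOh_injective_ray : ∀ a b, (∀ i j, yuOh a i * yuOh a j * (yuOh b ⬝ᵥ yuOh b) =
    yuOh b i * yuOh b j * (yuOh a ⬝ᵥ yuOh a)) → a = b := by
  decide

/-! ### Matrix units from the relations -/

section Algebra

variable {A : Type*} [Ring A] [Algebra ℝ A]

/-- The matrix units generated by a family `G` of projectors labelled by rays: the off-diagonal
one at `(i, j)` is cut out of the projector onto the ray of `e i + e j`. -/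
noncomputable def matrixUnit {ι : Type*} [DecidableEq ι] (G : (ι → ℤ) → A) (i j : ι) : A :=
  if i = j then G (Pi.single i 1) else
    (2 : ℝ) • (G (Pi.single i 1) * G (Pi.single i 1 + Pi.single j 1) * G (Pi.single j 1))

/-- `x` lies in the corner of `p + q` and squares to a quarter of `p + q`. The model is half the
swap of `e i` and `e j`, with `p` and `q` the projectors onto `e i` and `e j`. -/
structure IsHalfSwap (p q x : A) : Prop where
  left : (p + q) * x = x
  right : x * (p + q) = x
  sq : x * x = (4⁻¹ : ℝ) • (p + q)

theorem isHalfSwap_of_add_eq {p q f g : A} (hf : f * f = f) (hfg : f * g = 0) (hgf : g * f = 0)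
    (h : f + g = p + q) (hpq : (p + q) * (p + q) = p + q) :
    IsHalfSwap p q (f - (2⁻¹ : ℝ) • (p + q)) where
  left := by
    have : (p + q) * f = f := by rw [← h, add_mul, hf, hgf, add_zero]
    rw [mul_sub, this, mul_smul_comm, hpq]
  right := by
    have : f * (p + q) = f := by rw [← h, mul_add, hf, hfg, add_zero]
    rw [sub_mul, this, smul_mul_assoc, hpq]
  sq := by
    have h1 : (p + q) * f = f := by rw [← h, add_mul, hf, hgf, add_zero]
    have h2 : f * (p + q) = f := by rw [← h, mul_add, hf, hfg, add_zero]
    rw [sub_mul, mul_sub, mul_sub, hf, mul_smul_comm, h2, smul_mul_assoc, h1, smul_mul_smul_comm,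
      hpq]
    module

theorem IsHalfSwap.mul_eq_zero {p q r x : A} (hx : IsHalfSwap p q x) (hp : r * p = 0)
    (hq : r * q = 0) : r * x = 0 := by
  rw [← hx.left, ← mul_assoc, mul_add, hp, hq, add_zero, zero_mul]

theorem IsHalfSwap.mul_eq_zero' {p q r x : A} (hx : IsHalfSwap p q x) (hp : p * r = 0)
    (hq : q * r = 0) : x * r = 0 := by
  rw [← hx.right, mul_assoc, add_mul, hp, hq, add_zero, mul_zero]

/-- Three half swaps that are, up to a factor, the anticommutators of each other have no diagonal
blocks, and their off-diagonal blocks compose like matrix units. -/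
theorem IsHalfSwap.relations {p q r x y z : A}
    (hp : p * p = p) (hq : q * q = q) (hpq : p * q = 0) (hqp : q * p = 0)
    (hpr : p * r = 0) (hrp : r * p = 0) (hqr : q * r = 0) (hrq : r * q = 0)
    (hx : IsHalfSwap p q x) (hy : IsHalfSwap p r y) (hz : IsHalfSwap q r z)
    (hxyz : x = (2 : ℝ) • (y * z + z * y)) (hyxz : y = (2 : ℝ) • (x * z + z * x)) :
    x = p * x * q + q * x * p ∧
    (2 : ℝ) • (p * x * q) * (2 : ℝ) • (q * x * p) = p ∧
    (2 : ℝ) • (p * x * q) * (2 : ℝ) • (q * z * r) = (2 : ℝ) • (p * y * r) := by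
  have hqy : q * y = 0 := hy.mul_eq_zero hqp hqr
  have hyq : y * q = 0 := hy.mul_eq_zero' hpq hrq
  have hpz : p * z = 0 := hz.mul_eq_zero hpq hpr
  have hzp : z * p = 0 := hz.mul_eq_zero' hqp hrp
  have hpxp : p * x * p = 0 := by
    rw [hxyz, mul_smul_comm, smul_mul_assoc, mul_add, ← mul_assoc p z, hpz, zero_mul, add_zero,
      mul_assoc, mul_assoc, hzp, mul_zero, mul_zero, smul_zero]
  have hqxq : q * x * q = 0 := by
    rw [hxyz, mul_smul_comm, smul_mul_assoc, mul_add, ← mul_assoc q y, hqy, zero_mul, zero_add,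
      mul_assoc, mul_assoc, hyq, mul_zero, mul_zero, smul_zero]
  refine ⟨?_, ?_, ?_⟩
  · calc x = (p + q) * x * (p + q) := by rw [hx.left, hx.right]
      _ = p * x * p + q * x * q + (p * x * q + q * x * p) := by noncomm_ring
      _ = _ := by rw [hpxp, hqxq, zero_add, zero_add]
  · have h1 : p * x * q * (q * x * p) = (4⁻¹ : ℝ) • p := by
      calc p * x * q * (q * x * p) = p * x * (q * q) * x * p := by simp only [mul_assoc]
        _ = p * (x * (p + q)) * x * p - p * x * p * x * p := by rw [hq]; noncomm_ring
        _ = p * (x * x) * p := by rw [hx.right, hpxp]; simp only [zero_mul, sub_zero, mul_assoc]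
        _ = (4⁻¹ : ℝ) • p := by
          rw [hx.sq, mul_smul_comm, smul_mul_assoc, mul_add, hp, hpq, add_zero, hp]
    rw [smul_mul_smul_comm, h1, smul_smul]
    norm_num
  · have h1 : p * x * q * (q * z * r) = p * x * z * r := by
      calc p * x * q * (q * z * r) = p * x * (q * q) * z * r := by simp only [mul_assoc]
        _ = p * (x * (p + q)) * z * r - p * x * (p * z) * r := by rw [hq]; noncomm_ring
        _ = p * x * z * r := by
          rw [hx.right, hpz]; simp only [mul_zero, zero_mul, sub_zero]
    have h2 : p * y * r = (2 : ℝ) • (p * x * z * r) := by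
      conv_lhs => rw [hyxz]
      rw [mul_smul_comm, smul_mul_assoc, mul_add, ← mul_assoc p z, hpz, zero_mul, add_zero,
        ← mul_assoc]
    rw [smul_mul_smul_comm, h1, h2, smul_smul]

/-- For half swaps `x`, `y`, `z` of the three pairs of coordinates and `s` the sum of the three
basis projectors, the four elements are the projectors onto the rays of `(1, ±1, ±1)`. That they
are idempotent makes one half swap an anticommutator of the two others: the equation is the Fourier
component of the four idempotency equations along a nontrivial character of the sign changes. -/
theorem anticommutator_of_isIdempotentElem {s x y z : A} (hsz : s * z = z) (hzs : z * s = z)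
    (h1 : IsIdempotentElem ((3⁻¹ : ℝ) • s + (2 / 3 : ℝ) • (x + y + z)))
    (h2 : IsIdempotentElem ((3⁻¹ : ℝ) • s + (2 / 3 : ℝ) • (x - y - z)))
    (h3 : IsIdempotentElem ((3⁻¹ : ℝ) • s + (2 / 3 : ℝ) • (-x + y - z)))
    (h4 : IsIdempotentElem ((3⁻¹ : ℝ) • s + (2 / 3 : ℝ) • (-x - y + z))) :
    z = (2 : ℝ) • (x * y + y * x) := by
  have e1 := h1.eq
  have e2 := h2.eq
  have e3 := h3.eq
  have e4 := h4.eq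
  simp only [add_mul, mul_add, sub_mul, mul_sub, neg_mul, mul_neg, smul_add,
    smul_sub, smul_neg, smul_mul_assoc, mul_smul_comm, hsz, hzs, smul_smul] at e1 e2 e3 e4
  have key : (0 : A) = z - (2 : ℝ) • (x * y + y * x) := by
    linear_combination (norm := module) (9 / 8 : ℝ) • (e1 - e2 - e3 + e4)
  exact (sub_eq_zero.1 key.symm)

theorem matrixUnit_self {ι : Type*} [DecidableEq ι] (G : (ι → ℤ) → A) (i : ι) :
    matrixUnit G i i = G (Pi.single i 1) := if_pos rfl

/-- The thirteen projectors are determined by the matrix units that they generate. -/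
theorem matrixUnit_of_yuOh_relations {G : (Fin 3 → ℤ) → A} {o : A}
    (hid : ∀ a, G (yuOh a) * G (yuOh a) = G (yuOh a))
    (horth : ∀ a b, yuOh a ⬝ᵥ yuOh b = 0 → G (yuOh a) * G (yuOh b) = 0)
    (hrel : ∀ k, ∑ a, (yuOhCoeff k a : ℝ) • G (yuOh a) + (yuOhConst k : ℝ) • o =
      (yuOhConst k : ℝ) • 1) :
    matrixUnit G 0 1 * matrixUnit G 1 0 = matrixUnit G 0 0 ∧
    matrixUnit G 0 1 * matrixUnit G 1 2 = matrixUnit G 0 2 ∧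
    ∀ a, G (yuOh a) = ∑ i, ∑ j,
      (((yuOh a i * yuOh a j : ℤ) : ℝ) / ((yuOh a ⬝ᵥ yuOh a : ℤ) : ℝ)) • matrixUnit G i j := by
  -- `F` names the projectors in the order of `yuOh`: the basis is `0, 1, 2`, the sums of two basis
  -- vectors are `3, 5, 7`, and the rays of `(1, ±1, ±1)` are `9, …, 12`.
  obtain ⟨F, hF⟩ : ∃ F : Fin 13 → A, ∀ a, G (yuOh a) = F a := ⟨_, fun _ => rfl⟩
  have g0 : G (Pi.single 0 1) = F 0 := by rw [← hF]; congr 1; decide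
  have g1 : G (Pi.single 1 1) = F 1 := by rw [← hF]; congr 1; decide
  have g2 : G (Pi.single 2 1) = F 2 := by rw [← hF]; congr 1; decide
  have g01 : G (Pi.single 0 1 + Pi.single 1 1) = F 7 := by rw [← hF]; congr 1; decide
  have g10 : G (Pi.single 1 1 + Pi.single 0 1) = F 7 := by rw [← hF]; congr 1; decide
  have g02 : G (Pi.single 0 1 + Pi.single 2 1) = F 5 := by rw [← hF]; congr 1; decide
  have g20 : G (Pi.single 2 1 + Pi.single 0 1) = F 5 := by rw [← hF]; congr 1; decide
  have g12 : G (Pi.single 1 1 + Pi.single 2 1) = F 3 := by rw [← hF]; congr 1; decide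
  have g21 : G (Pi.single 2 1 + Pi.single 1 1) = F 3 := by rw [← hF]; congr 1; decide
  simp only [hF] at hid horth hrel ⊢
  have hrel' := fun k => hrel k
  simp only [Fin.sum_univ_succ, Fin.sum_univ_zero] at hrel'
  have r0 := hrel' 0
  have r1 := hrel' 1
  have r2 := hrel' 2
  have r3 := hrel' 3
  have r4 := hrel' 4
  have r5 := hrel' 5
  have r6 := hrel' 6
  have r7 := hrel' 7
  clear hrel hrel'
  simp [yuOhCoeff, yuOhConst, Fin.succ] at r0 r1 r2 r3 r4 r5 r6 r7
  have h3 : F 3 + F 4 = F 1 + F 2 := by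
    linear_combination (norm := module) (1 / 4 : ℝ) • (r4 + r5) - (2 : ℝ) • r7
  have h5 : F 5 + F 6 = F 0 + F 2 := by
    linear_combination (norm := module) (1 / 4 : ℝ) • (r4 + r6) - (2 : ℝ) • r7
  have h7 : F 7 + F 8 = F 0 + F 1 := by
    linear_combination (norm := module) (1 / 4 : ℝ) • (r5 + r6) - (2 : ℝ) • r7
  have z01 : F 0 * F 1 = 0 := horth 0 1 (by decide)
  have z10 : F 1 * F 0 = 0 := horth 1 0 (by decide)
  have z02 : F 0 * F 2 = 0 := horth 0 2 (by decide)
  have z20 : F 2 * F 0 = 0 := horth 2 0 (by decide)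
  have z12 : F 1 * F 2 = 0 := horth 1 2 (by decide)
  have z21 : F 2 * F 1 = 0 := horth 2 1 (by decide)
  obtain ⟨x, hx⟩ : ∃ x, x = F 7 - (2⁻¹ : ℝ) • (F 0 + F 1) := ⟨_, rfl⟩
  obtain ⟨y, hy⟩ : ∃ y, y = F 5 - (2⁻¹ : ℝ) • (F 0 + F 2) := ⟨_, rfl⟩
  obtain ⟨z, hz⟩ : ∃ z, z = F 3 - (2⁻¹ : ℝ) • (F 1 + F 2) := ⟨_, rfl⟩
  have sx : IsHalfSwap (F 0) (F 1) x := hx ▸ isHalfSwap_of_add_eq (hid 7)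
    (horth 7 8 (by decide)) (horth 8 7 (by decide)) h7
    (by simp only [add_mul, mul_add, hid, z01, z10, add_zero, zero_add])
  have sy : IsHalfSwap (F 0) (F 2) y := hy ▸ isHalfSwap_of_add_eq (hid 5)
    (horth 5 6 (by decide)) (horth 6 5 (by decide)) h5
    (by simp only [add_mul, mul_add, hid, z02, z20, add_zero, zero_add])
  have sz : IsHalfSwap (F 1) (F 2) z := hz ▸ isHalfSwap_of_add_eq (hid 3)
    (horth 3 4 (by decide)) (horth 4 3 (by decide)) h3
    (by simp only [add_mul, mul_add, hid, z12, z21, add_zero, zero_add])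
  have f9 : F 9 = (3⁻¹ : ℝ) • (F 0 + F 1 + F 2) + (2 / 3 : ℝ) • (x + y + z) := by
    rw [hx, hy, hz]
    linear_combination (norm := module) (1 / 3 : ℝ) • r0 - r7 - (2 / 3 : ℝ) • (h3 + h5 + h7)
  have f10 : F 10 = (3⁻¹ : ℝ) • (F 0 + F 1 + F 2) + (2 / 3 : ℝ) • (x - y - z) := by
    rw [hx, hy, hz]
    linear_combination (norm := module) (1 / 3 : ℝ) • r1 - r7 - (2 / 3 : ℝ) • h7
  have f11 : F 11 = (3⁻¹ : ℝ) • (F 0 + F 1 + F 2) + (2 / 3 : ℝ) • (-x + y - z) := by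
    rw [hx, hy, hz]
    linear_combination (norm := module) (1 / 3 : ℝ) • r2 - r7 - (2 / 3 : ℝ) • h5
  have f12 : F 12 = (3⁻¹ : ℝ) • (F 0 + F 1 + F 2) + (2 / 3 : ℝ) • (-x - y + z) := by
    rw [hx, hy, hz]
    linear_combination (norm := module) (1 / 3 : ℝ) • r3 - r7 - (2 / 3 : ℝ) • h3
  have i9 : IsIdempotentElem (F 9) := hid 9
  have i10 : IsIdempotentElem (F 10) := hid 10
  have i11 : IsIdempotentElem (F 11) := hid 11
  have i12 : IsIdempotentElem (F 12) := hid 12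
  rw [f9] at i9
  rw [f10] at i10
  rw [f11] at i11
  rw [f12] at i12
  have az : z = (2 : ℝ) • (x * y + y * x) := by
    refine anticommutator_of_isIdempotentElem ?_ ?_ i9 i10 i11 i12
    · rw [add_assoc, add_mul, sz.left, sz.mul_eq_zero z01 z02, zero_add]
    · rw [add_assoc, mul_add, sz.right, sz.mul_eq_zero' z10 z20, zero_add]
  have ax : x = (2 : ℝ) • (y * z + z * y) := by
    refine anticommutator_of_isIdempotentElem (s := F 0 + F 1 + F 2) ?_ ?_ ?_ ?_ ?_ ?_
    · rw [add_mul, sx.left, sx.mul_eq_zero z20 z21, add_zero]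
    · rw [mul_add, sx.right, sx.mul_eq_zero' z02 z12, add_zero]
    · convert i9 using 3; abel
    · convert i11 using 3; abel
    · convert i12 using 3; abel
    · convert i10 using 3; abel
  have ay : y = (2 : ℝ) • (x * z + z * x) := by
    refine anticommutator_of_isIdempotentElem (s := F 0 + F 1 + F 2) ?_ ?_ ?_ ?_ ?_ ?_
    · rw [add_right_comm, add_mul, sy.left, sy.mul_eq_zero z10 z12, add_zero]
    · rw [add_right_comm, mul_add, sy.right, sy.mul_eq_zero' z01 z21, add_zero]
    · convert i9 using 3; abel
    · convert i10 using 3; abel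
    · convert i12 using 3; abel
    · convert i11 using 3; abel
  obtain ⟨ox, px, cx⟩ := sx.relations (hid 0) (hid 1) z01 z10 z02 z20 z12 z21 sy sz ax ay
  obtain ⟨oy, -, -⟩ := sy.relations (hid 0) (hid 2) z02 z20 z01 z10 z21 z12 sx
    ⟨by rw [add_comm, sz.left], by rw [add_comm, sz.right], by rw [add_comm, sz.sq]⟩ ay ax
  obtain ⟨oz, -, -⟩ := sz.relations (r := F 0) (x := z) (y := x) (z := y) (hid 1) (hid 2) z12 z21
    z10 z01 z20 z02
    ⟨by rw [add_comm, sx.left], by rw [add_comm, sx.right], by rw [add_comm, sx.sq]⟩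
    ⟨by rw [add_comm, sy.left], by rw [add_comm, sy.right], by rw [add_comm, sy.sq]⟩
    az (by rw [ax, add_comm])
  -- The corners of the projectors and of the half swaps agree.
  have c01 : F 0 * F 7 * F 1 = F 0 * x * F 1 := by
    rw [hx, mul_sub, sub_mul, mul_smul_comm, smul_mul_assoc, mul_add, add_mul, hid, z01, zero_mul,
      add_zero, smul_zero, sub_zero]
  have c10 : F 1 * F 7 * F 0 = F 1 * x * F 0 := by
    rw [hx, mul_sub, sub_mul, mul_smul_comm, smul_mul_assoc, mul_add, add_mul, hid, z10, zero_mul,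
      zero_add, smul_zero, sub_zero]
  have c02 : F 0 * F 5 * F 2 = F 0 * y * F 2 := by
    rw [hy, mul_sub, sub_mul, mul_smul_comm, smul_mul_assoc, mul_add, add_mul, hid, z02, zero_mul,
      add_zero, smul_zero, sub_zero]
  have c20 : F 2 * F 5 * F 0 = F 2 * y * F 0 := by
    rw [hy, mul_sub, sub_mul, mul_smul_comm, smul_mul_assoc, mul_add, add_mul, hid, z20, zero_mul,
      zero_add, smul_zero, sub_zero]
  have c12 : F 1 * F 3 * F 2 = F 1 * z * F 2 := by
    rw [hz, mul_sub, sub_mul, mul_smul_comm, smul_mul_assoc, mul_add, add_mul, hid, z12, zero_mul,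
      add_zero, smul_zero, sub_zero]
  have c21 : F 2 * F 3 * F 1 = F 2 * z * F 1 := by
    rw [hz, mul_sub, sub_mul, mul_smul_comm, smul_mul_assoc, mul_add, add_mul, hid, z21, zero_mul,
      zero_add, smul_zero, sub_zero]
  have m01 : matrixUnit G 0 1 = (2 : ℝ) • (F 0 * x * F 1) := by
    rw [matrixUnit, if_neg (by decide), g0, g1, g01, c01]
  have m10 : matrixUnit G 1 0 = (2 : ℝ) • (F 1 * x * F 0) := by
    rw [matrixUnit, if_neg (by decide), g0, g1, g10, c10]
  have m02 : matrixUnit G 0 2 = (2 : ℝ) • (F 0 * y * F 2) := by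
    rw [matrixUnit, if_neg (by decide), g0, g2, g02, c02]
  have m20 : matrixUnit G 2 0 = (2 : ℝ) • (F 2 * y * F 0) := by
    rw [matrixUnit, if_neg (by decide), g0, g2, g20, c20]
  have m12 : matrixUnit G 1 2 = (2 : ℝ) • (F 1 * z * F 2) := by
    rw [matrixUnit, if_neg (by decide), g1, g2, g12, c12]
  have m21 : matrixUnit G 2 1 = (2 : ℝ) • (F 2 * z * F 1) := by
    rw [matrixUnit, if_neg (by decide), g1, g2, g21, c21]
  have m0 : matrixUnit G 0 0 = F 0 := by rw [matrixUnit_self, g0]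
  have m1 : matrixUnit G 1 1 = F 1 := by rw [matrixUnit_self, g1]
  have m2 : matrixUnit G 2 2 = F 2 := by rw [matrixUnit_self, g2]
  have ex : x = (2⁻¹ : ℝ) • (matrixUnit G 0 1 + matrixUnit G 1 0) := by
    rw [m01, m10, ← smul_add, smul_smul, ← ox]; norm_num
  have ey : y = (2⁻¹ : ℝ) • (matrixUnit G 0 2 + matrixUnit G 2 0) := by
    rw [m02, m20, ← smul_add, smul_smul, ← oy]; norm_num
  have ez : z = (2⁻¹ : ℝ) • (matrixUnit G 1 2 + matrixUnit G 2 1) := by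
    rw [m12, m21, ← smul_add, smul_smul, ← oz]; norm_num
  refine ⟨by rw [m01, m10, m0]; exact px, by rw [m01, m12, m02]; exact cx, ?_⟩
  rw [← m0, ← m1, ← m2, ex, ey, ez] at f9 f10 f11 f12
  rw [ex, ← m0, ← m1] at hx
  rw [ey, ← m0, ← m2] at hy
  rw [ez, ← m1, ← m2] at hz
  rw [← m0, ← m1] at h7
  rw [← m0, ← m2] at h5
  rw [← m1, ← m2] at h3
  generalize matrixUnit G = E at *
  intro a
  simp only [Fin.sum_univ_three, dotProduct]
  fin_cases a
  · simp [yuOh, m0]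
  · simp [yuOh, m1]
  · simp [yuOh, m2]
  · simp [yuOh]
    linear_combination (norm := module) -hz
  · simp [yuOh]
    linear_combination (norm := module) h3 + hz
  · simp [yuOh]
    linear_combination (norm := module) -hy
  · simp [yuOh]
    linear_combination (norm := module) h5 + hy
  · simp [yuOh]
    linear_combination (norm := module) -hx
  · simp [yuOh]
    linear_combination (norm := module) h7 + hx
  · simp [yuOh]
    linear_combination (norm := module) f9
  · simp [yuOh]
    linear_combination (norm := module) f10
  · simp [yuOh]
    linear_combination (norm := module) f11
  · simp [yuOh]
    linear_combination (norm := module) f12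

end Algebra

/-! ### Projectors onto integer rays -/

section Rays

variable {d : ℕ}

/-- The projector onto the ray spanned by an integer vector (zero for the zero vector). -/
noncomputable def rayProj (u : Fin d → ℤ) : Matrix (Fin d) (Fin d) ℂ :=
  Matrix.of fun i j => ((((u i * u j : ℤ) : ℝ) / ((u ⬝ᵥ u : ℤ) : ℝ) : ℝ) : ℂ)

theorem rayProj_apply (u : Fin d → ℤ) (i j : Fin d) :
    rayProj u i j = ((((u i * u j : ℤ) : ℝ) / ((u ⬝ᵥ u : ℤ) : ℝ) : ℝ) : ℂ) := rfl

theorem rayProj_mul_rayProj_apply (u v : Fin d → ℤ) (i j : Fin d) :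
    (rayProj u * rayProj v) i j =
      (u i * v j * (u ⬝ᵥ v : ℤ) : ℂ) / ((u ⬝ᵥ u : ℤ) * (v ⬝ᵥ v : ℤ) : ℂ) := by
  have h : ((u ⬝ᵥ v : ℤ) : ℂ) = ∑ k, (u k : ℂ) * v k := by simp [dotProduct]
  rw [Matrix.mul_apply, h, Finset.mul_sum, Finset.sum_div]
  refine Finset.sum_congr rfl fun k _ => ?_
  simp only [rayProj_apply]
  push_cast
  ring

theorem rayProj_isStarProjection (u : Fin d → ℤ) : IsStarProjection (rayProj u) := by
  refine ⟨?_, ?_⟩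
  · ext i j
    rw [rayProj_mul_rayProj_apply, rayProj_apply]
    push_cast
    rcases eq_or_ne ((u ⬝ᵥ u : ℤ) : ℂ) 0 with h | h
    · simp [h]
    · field_simp
  · ext i j
    rw [Matrix.star_apply, rayProj_apply, rayProj_apply, mul_comm]
    exact Complex.conj_ofReal _

theorem rayProj_mul_eq_zero {u v : Fin d → ℤ} (h : u ⬝ᵥ v = 0) : rayProj u * rayProj v = 0 := by
  ext i j
  rw [rayProj_mul_rayProj_apply, h]
  simp

theorem rayProj_eq_iff {u v : Fin d → ℤ} (hu : u ⬝ᵥ u ≠ 0) (hv : v ⬝ᵥ v ≠ 0) :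
    rayProj u = rayProj v ↔ ∀ i j, u i * u j * (v ⬝ᵥ v) = v i * v j * (u ⬝ᵥ u) := by
  have hu' : ((u ⬝ᵥ u : ℤ) : ℝ) ≠ 0 := by exact_mod_cast hu
  have hv' : ((v ⬝ᵥ v : ℤ) : ℝ) ≠ 0 := by exact_mod_cast hv
  rw [← Matrix.ext_iff]
  refine forall_congr' fun i => forall_congr' fun j => ?_
  rw [rayProj_apply, rayProj_apply, Complex.ofReal_inj, div_eq_div_iff hu' hv']
  norm_cast

/-- Projectors onto distinct rays commute only if the rays are orthogonal. -/
theorem dot_eq_zero_of_commute {u v : Fin d → ℤ} (hu : u ⬝ᵥ u ≠ 0) (hv : v ⬝ᵥ v ≠ 0)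
    (hne : rayProj u ≠ rayProj v) (h : Commute (rayProj u) (rayProj v)) : u ⬝ᵥ v = 0 := by
  by_contra huv
  apply hne
  have hu' : ((u ⬝ᵥ u : ℤ) : ℂ) ≠ 0 := by exact_mod_cast hu
  have hv' : ((v ⬝ᵥ v : ℤ) : ℂ) ≠ 0 := by exact_mod_cast hv
  have huv' : ((u ⬝ᵥ v : ℤ) : ℂ) ≠ 0 := by exact_mod_cast huv
  have hpar : ∀ i j, u i * v j = v i * u j := by
    intro i j
    have h1 := congrFun (congrFun h.eq i) j
    rw [rayProj_mul_rayProj_apply, rayProj_mul_rayProj_apply, dotProduct_comm v u,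
      mul_comm ((v ⬝ᵥ v : ℤ) : ℂ), div_left_inj' (mul_ne_zero hu' hv')] at h1
    exact_mod_cast mul_right_cancel₀ huv' h1
  rw [rayProj_eq_iff hu hv]
  intro i j
  simp only [dotProduct, Finset.mul_sum]
  refine Finset.sum_congr rfl fun k _ => ?_
  linear_combination (u j * v k) * hpar i k + (v i * u k) * hpar j k

/-- The vector `x` placed in the three coordinates given by `σ`. -/
noncomputable def place (σ : Fin 3 ↪ Fin d) (x : Fin 3 → ℤ) : Fin d → ℤ := Function.extend σ x 0

theorem place_apply (σ : Fin 3 ↪ Fin d) (x : Fin 3 → ℤ) (i : Fin 3) : place σ x (σ i) = x i :=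
  σ.injective.extend_apply _ _ _

theorem place_of_notMem (σ : Fin 3 ↪ Fin d) (x : Fin 3 → ℤ) {l : Fin d} (h : l ∉ Set.range σ) :
    place σ x l = 0 :=
  Function.extend_apply' _ _ _ h

theorem place_dot (σ : Fin 3 ↪ Fin d) (x y : Fin 3 → ℤ) : place σ x ⬝ᵥ place σ y = x ⬝ᵥ y := by
  refine (Fintype.sum_of_injective σ σ.injective _ _ (fun l hl => ?_) fun i => ?_).symm
  · rw [place_of_notMem σ x hl, zero_mul]
  · rw [place_apply, place_apply]

theorem place_add (σ : Fin 3 ↪ Fin d) (x y : Fin 3 → ℤ) :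
    place σ (x + y) = place σ x + place σ y := by
  funext l
  by_cases h : l ∈ Set.range σ
  · obtain ⟨i, rfl⟩ := h
    simp only [Pi.add_apply, place_apply]
  · simp only [Pi.add_apply, place_of_notMem σ _ h, add_zero]

theorem place_single (σ : Fin 3 ↪ Fin d) (i : Fin 3) :
    place σ (Pi.single i 1) = Pi.single (σ i) 1 := by
  funext l
  by_cases h : l ∈ Set.range σ
  · obtain ⟨j, rfl⟩ := h
    rw [place_apply]
    simp [Pi.single_apply]
  · rw [place_of_notMem σ _ h, Pi.single_eq_of_ne]
    rintro rfl
    exact h ⟨i, rfl⟩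

theorem matrixUnit_place {A : Type*} [Ring A] [Algebra ℝ A] (G : (Fin d → ℤ) → A)
    (σ : Fin 3 ↪ Fin d) (i j : Fin 3) :
    matrixUnit (fun x => G (place σ x)) i j = matrixUnit G (σ i) (σ j) := by
  simp only [matrixUnit, place_add, place_single, σ.injective.eq_iff]

/-- The projectors onto the Yu–Oh rays of all the triples of coordinates. -/
def yuOhFamily (d : ℕ) : Set (Matrix (Fin d) (Fin d) ℂ) :=
  Set.range fun p : (Fin 3 ↪ Fin d) × Fin 13 => rayProj (place p.1 (yuOh p.2))

/-- The rays that enter the relations of the triple `σ`: the Yu–Oh rays in its span, and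
the remaining basis vectors, which complete the identity of the span to that of the space. -/
noncomputable def tripleRay (σ : Fin 3 ↪ Fin d) : Fin 13 ⊕ {l // l ∉ Set.range σ} → Fin d → ℤ :=
  Sum.elim (fun a => place σ (yuOh a)) fun l => Pi.single l.1 1

theorem rayProj_tripleRay_mem (σ : Fin 3 ↪ Fin d) (x : Fin 13 ⊕ {l // l ∉ Set.range σ}) :
    rayProj (tripleRay σ x) ∈ yuOhFamily d := by
  rcases x with a | l
  · exact ⟨(σ, a), rfl⟩
  · refine ⟨(σ.trans (Equiv.swap (σ 0) l.1).toEmbedding, 0), ?_⟩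
    have h : yuOh 0 = Pi.single 0 1 := by decide
    simp [tripleRay, h, place_single]

theorem yuOh_dot_self_ne : ∀ a, yuOh a ⬝ᵥ yuOh a ≠ 0 := by decide

theorem tripleRay_dot_self_ne (σ : Fin 3 ↪ Fin d) (x : Fin 13 ⊕ {l // l ∉ Set.range σ}) :
    tripleRay σ x ⬝ᵥ tripleRay σ x ≠ 0 := by
  rcases x with a | l
  · simpa only [tripleRay, Sum.elim_inl, place_dot] using yuOh_dot_self_ne a
  · simp [tripleRay]

theorem rayProj_tripleRay_injective (σ : Fin 3 ↪ Fin d) :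
    Function.Injective fun x => rayProj (tripleRay σ x) := by
  have key : ∀ a (l : {l // l ∉ Set.range σ}),
      rayProj (tripleRay σ (Sum.inl a)) ≠ rayProj (tripleRay σ (Sum.inr l)) := by
    intro a l h
    have := (rayProj_eq_iff (tripleRay_dot_self_ne σ _) (tripleRay_dot_self_ne σ _)).1 h l.1 l.1
    simp only [tripleRay, Sum.elim_inl, Sum.elim_inr, place_of_notMem σ _ l.2, place_dot,
      Pi.single_eq_same, zero_mul, one_mul] at this
    exact yuOh_dot_self_ne a this.symm
  rintro (a | l) (b | m) h
  · congr 1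
    refine yuOh_injective_ray a b fun i j => ?_
    have := (rayProj_eq_iff (tripleRay_dot_self_ne σ _) (tripleRay_dot_self_ne σ _)).1 h (σ i) (σ j)
    simpa only [tripleRay, Sum.elim_inl, place_apply, place_dot] using this
  · exact absurd h (key a m)
  · exact absurd h.symm (key b l)
  · have := (rayProj_eq_iff (tripleRay_dot_self_ne σ _) (tripleRay_dot_self_ne σ _)).1 h l.1 l.1
    congr 1
    by_contra hne
    have hne' : l.1 ≠ m.1 := fun h' => hne (Subtype.ext h')
    simp [tripleRay, hne'] at this

/-- The coefficients, on `tripleRay σ`, of the relations of the triple `σ`. -/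
def tripleCoeff (σ : Fin 3 ↪ Fin d) (k : Fin 8) : Fin 13 ⊕ {l // l ∉ Set.range σ} → ℝ :=
  Sum.elim (fun a => (yuOhCoeff k a : ℝ)) fun _ => (yuOhConst k : ℝ)

theorem sum_tripleCoeff_mul_eq_zero (σ : Fin 3 ↪ Fin d)
    {x y : Fin 13 ⊕ {l // l ∉ Set.range σ}} (hxy : x ≠ y)
    (h : tripleRay σ x ⬝ᵥ tripleRay σ y ≠ 0) : ∑ k, tripleCoeff σ k x * tripleCoeff σ k y = 0 := by
  rcases x with a | l <;> rcases y with b | m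
  · simp only [tripleRay, Sum.elim_inl, place_dot] at h
    have := sum_yuOhCoeff_mul_eq_zero a b (fun h' => hxy (by rw [h'])) h
    simp only [tripleCoeff, Sum.elim_inl]
    exact_mod_cast this
  · exact absurd (by simp [tripleRay, place_of_notMem σ _ m.2]) h
  · exact absurd (by simp [tripleRay, place_of_notMem σ _ l.2]) h
  · refine absurd ?_ h
    have hne : l.1 ≠ m.1 := fun h' => hxy (by rw [Subtype.ext h'])
    simp [tripleRay, hne]

theorem sum_tripleCoeff_weight_pos (σ : Fin 3 ↪ Fin d) (x : Fin 13 ⊕ {l // l ∉ Set.range σ}) :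
    0 < ∑ k, (2 * (yuOhConst k : ℝ) * tripleCoeff σ k x - tripleCoeff σ k x ^ 2) := by
  rcases x with a | l
  · simp only [tripleCoeff, Sum.elim_inl]
    exact_mod_cast yuOhWeight_pos a
  · simp only [tripleCoeff, Sum.elim_inr]
    have : 0 < ∑ k, (2 * yuOhConst k * yuOhConst k - yuOhConst k ^ 2) := by decide
    exact_mod_cast this

theorem sum_tripleCoeff_smul_rayProj (σ : Fin 3 ↪ Fin d) (k : Fin 8) :
    ∑ x, tripleCoeff σ k x • rayProj (tripleRay σ x) = (yuOhConst k : ℝ) • 1 := by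
  have hloc : ∀ i j : Fin 3, ∑ a, (yuOhCoeff k a : ℝ) *
      (((yuOh a i * yuOh a j : ℤ) : ℝ) / ((yuOh a ⬝ᵥ yuOh a : ℤ) : ℝ)) =
      yuOhConst k * (1 : Matrix (Fin 3) (Fin 3) ℝ) i j := by
    intro i j
    have h1 : ((∑ a, yuOhCoeff k a * (6 / (yuOh a ⬝ᵥ yuOh a)) * (yuOh a i * yuOh a j) : ℤ) : ℝ) =
        ((6 * yuOhConst k * (1 : Matrix (Fin 3) (Fin 3) ℤ) i j : ℤ) : ℝ) := by
      rw [sum_yuOhCoeff_mul_entry]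
    have h2 : (((1 : Matrix (Fin 3) (Fin 3) ℤ) i j : ℤ) : ℝ) =
        (1 : Matrix (Fin 3) (Fin 3) ℝ) i j := by
      by_cases hij : i = j <;> simp [Matrix.one_apply, hij]
    rw [Int.cast_sum] at h1
    have h3 : ∀ a, ((yuOhCoeff k a * (6 / (yuOh a ⬝ᵥ yuOh a)) * (yuOh a i * yuOh a j) : ℤ) : ℝ) =
        6 * ((yuOhCoeff k a : ℝ) *
          (((yuOh a i * yuOh a j : ℤ) : ℝ) / ((yuOh a ⬝ᵥ yuOh a : ℤ) : ℝ))) := by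
      intro a
      have h4 : ((yuOh a ⬝ᵥ yuOh a : ℤ) : ℝ) ≠ 0 := by exact_mod_cast yuOh_dot_self_ne a
      have h5 : ((6 / (yuOh a ⬝ᵥ yuOh a) : ℤ) : ℝ) * ((yuOh a ⬝ᵥ yuOh a : ℤ) : ℝ) = 6 := by
        exact_mod_cast yuOh_dot_self_dvd a
      rw [Int.cast_mul, Int.cast_mul, eq_div_of_mul_eq h4 h5]
      ring
    simp only [h3, ← Finset.mul_sum] at h1
    push_cast at h1 ⊢
    rw [h2] at h1
    linarith
  ext i j
  have hc : ∀ (r s : ℝ), r • (s : ℂ) = ((r * s : ℝ) : ℂ) := fun r s => by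
    rw [Complex.real_smul, Complex.ofReal_mul]
  simp only [Fintype.sum_sum_type, tripleCoeff, tripleRay, Sum.elim_inl, Sum.elim_inr,
    Matrix.sum_apply, Matrix.smul_apply, rayProj_apply, place_dot, hc]
  have h1 : ((1 : Matrix (Fin d) (Fin d) ℂ) i j) =
      (((1 : Matrix (Fin d) (Fin d) ℝ) i j : ℝ) : ℂ) := by
    by_cases hij : i = j <;> simp [Matrix.one_apply, hij]
  rw [h1, hc]
  simp only [← Complex.ofReal_sum, ← Complex.ofReal_add]
  rw [Complex.ofReal_inj]
  by_cases hi : i ∈ Set.range σ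
  · have hz : ∀ l : {l // l ∉ Set.range σ}, (Pi.single l.1 1 : Fin d → ℤ) i = 0 := by
      intro l
      refine Pi.single_eq_of_ne ?_ _
      rintro rfl
      exact l.2 hi
    simp only [hz, zero_mul, Int.cast_zero, zero_div, mul_zero, Finset.sum_const_zero, add_zero]
    obtain ⟨i', rfl⟩ := hi
    by_cases hj : j ∈ Set.range σ
    · obtain ⟨j', rfl⟩ := hj
      simp only [place_apply]
      rw [hloc]
      simp [Matrix.one_apply]
    · have hne : σ i' ≠ j := fun h => hj ⟨i', h⟩
      simp [place_of_notMem σ _ hj, hne]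
  · simp only [place_of_notMem σ _ hi, zero_mul, Int.cast_zero, zero_div, mul_zero,
      Finset.sum_const_zero, zero_add]
    rw [Finset.sum_eq_single (⟨i, hi⟩ : {l // l ∉ Set.range σ})]
    · by_cases hij : i = j
      · subst hij
        simp
      · simp [hij, Ne.symm hij]
    · intro l _ hl
      have : i ≠ l.1 := fun h => hl (Subtype.ext h.symm)
      simp [this]
    · simp

end Rays

/-! ### Rigidity of the family -/

/-- The embedding of three indices with prescribed distinct values. -/
def tripleEmbedding (i j k : Fin d) (hij : i ≠ j) (hik : i ≠ k) (hjk : j ≠ k) : Fin 3 ↪ Fin d where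
  toFun := ![i, j, k]
  inj' a b h := by
    fin_cases a <;> fin_cases b <;> simp_all [eq_comm]

theorem exists_ne_ne (hd : 3 ≤ d) (i j : Fin d) : ∃ k, i ≠ k ∧ j ≠ k := by
  obtain ⟨k, -, hk⟩ := Finset.exists_mem_notMem_of_card_lt_card (s := {i, j}) (t := Finset.univ)
    (lt_of_le_of_lt Finset.card_le_two (by rw [Finset.card_univ, Fintype.card_fin]; omega))
  simp only [Finset.mem_insert, Finset.mem_singleton, not_or] at hk
  exact ⟨k, fun h => hk.1 h.symm, fun h => hk.2 h.symm⟩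

/-- An assignment of projectors to rays that respects orthogonality and the linear relations
within each triple of coordinates. -/
structure RayRealization {d D : ℕ} (G : (Fin d → ℤ) → Matrix (Fin D) (Fin D) ℂ) : Prop where
  isStarProjection : ∀ σ x, IsStarProjection (G (tripleRay σ x))
  mul_eq_zero : ∀ σ x y, tripleRay σ x ⬝ᵥ tripleRay σ y = 0 →
    G (tripleRay σ x) * G (tripleRay σ y) = 0
  sum_eq : ∀ σ k, ∑ x, tripleCoeff σ k x • G (tripleRay σ x) = (yuOhConst k : ℝ) • 1

namespace RayRealization

variable {d D : ℕ} {G : (Fin d → ℤ) → Matrix (Fin D) (Fin D) ℂ}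

/-- The rigidity of the Yu–Oh rays, applied to the triple `σ`. -/
theorem matrixUnit_triple (hG : RayRealization G) (σ : Fin 3 ↪ Fin d) :
    matrixUnit G (σ 0) (σ 1) * matrixUnit G (σ 1) (σ 0) = matrixUnit G (σ 0) (σ 0) ∧
    matrixUnit G (σ 0) (σ 1) * matrixUnit G (σ 1) (σ 2) = matrixUnit G (σ 0) (σ 2) ∧
    ∀ a, G (place σ (yuOh a)) = ∑ i, ∑ j,
      (((yuOh a i * yuOh a j : ℤ) : ℝ) / ((yuOh a ⬝ᵥ yuOh a : ℤ) : ℝ)) •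
        matrixUnit G (σ i) (σ j) := by
  have h := matrixUnit_of_yuOh_relations (G := fun x => G (place σ x))
    (o := ∑ l : {l // l ∉ Set.range σ}, G (Pi.single l.1 1))
    (fun a => (hG.isStarProjection σ (Sum.inl a)).isIdempotentElem.eq)
    (fun a b hab => hG.mul_eq_zero σ (Sum.inl a) (Sum.inl b)
      (by simpa only [tripleRay, Sum.elim_inl, place_dot] using hab))
    (fun k => by
      have := hG.sum_eq σ k
      rw [Fintype.sum_sum_type] at this
      simpa only [tripleCoeff, tripleRay, Sum.elim_inl, Sum.elim_inr, Finset.smul_sum] using this)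
  simpa only [matrixUnit_place] using h

theorem single_isStarProjection (hG : RayRealization G) (hd : 3 ≤ d) (i : Fin d) :
    IsStarProjection (G (Pi.single i 1)) := by
  obtain ⟨j, hij, -⟩ := exists_ne_ne hd i i
  obtain ⟨k, hik, hjk⟩ := exists_ne_ne hd i j
  have := hG.isStarProjection (tripleEmbedding i j k hij hik hjk) (Sum.inl 0)
  have h0 : yuOh 0 = Pi.single 0 1 := by decide
  simpa only [tripleRay, Sum.elim_inl, h0, place_single] using! this

theorem single_mul_single (hG : RayRealization G) (hd : 3 ≤ d) {i j : Fin d} (hij : i ≠ j) :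
    G (Pi.single i 1) * G (Pi.single j 1) = 0 := by
  obtain ⟨k, hik, hjk⟩ := exists_ne_ne hd i j
  have := hG.mul_eq_zero (tripleEmbedding i j k hij hik hjk) (Sum.inl 0) (Sum.inl 1)
  have h0 : yuOh 0 = Pi.single 0 1 := by decide
  have h1 : yuOh 1 = Pi.single 1 1 := by decide
  simp only [tripleRay, Sum.elim_inl, h0, h1, place_dot] at this
  simpa only [place_single] using! this (by decide)

theorem single_add_single_isStarProjection (hG : RayRealization G) (hd : 3 ≤ d) {i j : Fin d}
    (hij : i ≠ j) : IsStarProjection (G (Pi.single i 1 + Pi.single j 1)) := by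
  obtain ⟨k, hik, hjk⟩ := exists_ne_ne hd i j
  have := hG.isStarProjection (tripleEmbedding i j k hij hik hjk) (Sum.inl 7)
  have h7 : yuOh 7 = Pi.single 0 1 + Pi.single 1 1 := by decide
  simpa only [tripleRay, Sum.elim_inl, h7, place_add, place_single] using! this

theorem single_mul_matrixUnit (hG : RayRealization G) (hd : 3 ≤ d) (i j : Fin d) :
    G (Pi.single i 1) * matrixUnit G i j = matrixUnit G i j := by
  have h := (hG.single_isStarProjection hd i).isIdempotentElem.eq
  rw [matrixUnit]
  split_ifs
  · exact h
  · rw [mul_smul_comm, ← mul_assoc, ← mul_assoc, h]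

theorem matrixUnit_mul_single (hG : RayRealization G) (hd : 3 ≤ d) (i j : Fin d) :
    matrixUnit G i j * G (Pi.single j 1) = matrixUnit G i j := by
  have h := (hG.single_isStarProjection hd j).isIdempotentElem.eq
  rw [matrixUnit]
  split_ifs with hij
  · rw [hij, h]
  · rw [smul_mul_assoc, mul_assoc, h]

theorem sum_single (hG : RayRealization G) (hd : 3 ≤ d) : ∑ i, G (Pi.single i 1) = 1 := by
  classical
  let σ : Fin 3 ↪ Fin d := (Fin.castLEEmb hd)
  have h := hG.sum_eq σ 7
  have h0 : yuOh 0 = Pi.single 0 1 := by decide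
  have h1 : yuOh 1 = Pi.single 1 1 := by decide
  have h2 : yuOh 2 = Pi.single 2 1 := by decide
  have hloc : ∑ a, (yuOhCoeff 7 a : ℝ) • G (place σ (yuOh a)) =
      ∑ i, G (Pi.single (σ i) 1) := by
    rw [Fin.sum_univ_three]
    have hz : ∀ a : Fin 10, yuOhCoeff 7 (Fin.natAdd 3 a) = 0 := by decide
    have hone : ∀ a : Fin 3, yuOhCoeff 7 (Fin.castAdd 10 a) = 1 := by decide
    rw [Fin.sum_univ_add (a := 3) (b := 10)]
    simp only [hz, hone, Int.cast_zero, Int.cast_one, zero_smul, one_smul,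
      Finset.sum_const_zero, add_zero, Fin.sum_univ_three]
    rw [← place_single, ← place_single, ← place_single, ← h0, ← h1, ← h2]
    rfl
  rw [Fintype.sum_sum_type] at h
  simp only [tripleCoeff, tripleRay, Sum.elim_inl, Sum.elim_inr] at h
  rw [hloc] at h
  have hc' : yuOhConst 7 = 1 := by decide
  have hc : (yuOhConst 7 : ℝ) = 1 := by exact_mod_cast hc'
  simp only [hc, one_smul] at h
  rw [← h, ← Fintype.sum_subtype_add_sum_subtype (fun l => l ∈ Set.range σ)]
  have hσ : ∑ i, G (Pi.single (σ i) 1) =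
      ∑ l : {l // l ∈ Set.range σ}, G (Pi.single l.1 1) :=
    Fintype.sum_equiv (Equiv.ofInjective σ σ.injective) _
      (fun l : {l // l ∈ Set.range σ} => G (Pi.single l.1 1)) fun _ => rfl
  rw [hσ]
  congr!

theorem isMatrixUnits (hG : RayRealization G) (hd : 3 ≤ d) : IsMatrixUnits (matrixUnit G) where
  mul_same i j k := by
    by_cases hij : i = j
    · subst hij
      rw [matrixUnit_self, hG.single_mul_matrixUnit hd]
    by_cases hjk : j = k
    · subst hjk
      rw [matrixUnit_self, hG.matrixUnit_mul_single hd]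
    by_cases hik : i = k
    · subst hik
      obtain ⟨l, hil, hjl⟩ := exists_ne_ne hd i j
      exact (hG.matrixUnit_triple (tripleEmbedding i j l hij hil hjl)).1
    · exact (hG.matrixUnit_triple (tripleEmbedding i j k hij hik hjk)).2.1
  mul_of_ne i j k l hjk := by
    rw [← hG.matrixUnit_mul_single hd i j, ← hG.single_mul_matrixUnit hd k l, mul_assoc,
      ← mul_assoc (G (Pi.single j 1)), hG.single_mul_single hd hjk, zero_mul, mul_zero]
  sum_diag := by
    simp only [matrixUnit_self]
    exact hG.sum_single hd
  conjTranspose i j := by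
    have h : ∀ l, (G (Pi.single l 1))ᴴ = G (Pi.single l 1) := fun l =>
      (hG.single_isStarProjection hd l).isSelfAdjoint
    by_cases hij : i = j
    · subst hij
      rw [matrixUnit_self, h]
    · have h' : (G (Pi.single i 1 + Pi.single j 1))ᴴ = G (Pi.single i 1 + Pi.single j 1) :=
        (hG.single_add_single_isStarProjection hd hij).isSelfAdjoint
      rw [matrixUnit, matrixUnit, if_neg hij, if_neg (Ne.symm hij), Matrix.conjTranspose_smul,
        Matrix.conjTranspose_mul, Matrix.conjTranspose_mul, h, h, h', star_trivial, ← mul_assoc,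
        add_comm (Pi.single j 1 : Fin d → ℤ)]

/-- The matrix units determine the projectors in the same way as the entries of the projectors
onto the rays. -/
theorem eq_sum (hG : RayRealization G) (σ : Fin 3 ↪ Fin d) (a : Fin 13) :
    G (place σ (yuOh a)) = ∑ i, ∑ j,
      (((place σ (yuOh a) i * place σ (yuOh a) j : ℤ) : ℝ) /
        ((place σ (yuOh a) ⬝ᵥ place σ (yuOh a) : ℤ) : ℝ)) • matrixUnit G i j := by
  rw [(hG.matrixUnit_triple σ).2.2 a]
  refine Fintype.sum_of_injective σ σ.injective _ _ (fun i hi => ?_) fun i => ?_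
  · simp [place_of_notMem σ _ hi]
  · refine Fintype.sum_of_injective σ σ.injective _ _ (fun j hj => ?_) fun j => ?_
    · simp [place_of_notMem σ _ hj]
    · rw [place_apply, place_apply, place_dot]

end RayRealization

/-! ### The family of all Yu–Oh rays -/

section Family

variable {d D n : ℕ} {S : Fin n → Matrix (Fin d) (Fin d) ℂ}

theorem exists_tripleIndex (hS : Set.range S = yuOhFamily d) (σ : Fin 3 ↪ Fin d) :
    ∃ f : Fin 13 ⊕ {l // l ∉ Set.range σ} → Fin n, ∀ x, S (f x) = rayProj (tripleRay σ x) := by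
  have h : ∀ x, ∃ i, S i = rayProj (tripleRay σ x) := fun x => by
    have := rayProj_tripleRay_mem σ x
    rwa [← hS] at this
  exact ⟨fun x => (h x).choose, fun x => (h x).choose_spec⟩

/-- The position in the family `S` of the projector onto a ray of the triple `σ`. -/
noncomputable def tripleIndex (hS : Set.range S = yuOhFamily d) (σ : Fin 3 ↪ Fin d) :
    Fin 13 ⊕ {l // l ∉ Set.range σ} → Fin n :=
  (exists_tripleIndex hS σ).choose

theorem apply_tripleIndex (hS : Set.range S = yuOhFamily d) (σ : Fin 3 ↪ Fin d)
    (x : Fin 13 ⊕ {l // l ∉ Set.range σ}) : S (tripleIndex hS σ x) = rayProj (tripleRay σ x) :=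
  (exists_tripleIndex hS σ).choose_spec x

theorem tripleIndex_injective (hS : Set.range S = yuOhFamily d) (σ : Fin 3 ↪ Fin d) :
    Function.Injective (tripleIndex hS σ) := fun x y h =>
  rayProj_tripleRay_injective σ (by
    simpa only [apply_tripleIndex] using congrArg S h)

/-- The coefficients of the relations of all the triples, as functions on the whole family. -/
noncomputable def familyCoeff (hS : Set.range S = yuOhFamily d) (k : (Fin 3 ↪ Fin d) × Fin 8) :
    Fin n → ℝ :=
  Function.extend (tripleIndex hS k.1) (tripleCoeff k.1 k.2) 0

/-- The right-hand sides of the relations with coefficients `familyCoeff`. -/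
def familyConst (k : (Fin 3 ↪ Fin d) × Fin 8) : ℝ := yuOhConst k.2

theorem familyCoeff_tripleIndex (hS : Set.range S = yuOhFamily d) (σ : Fin 3 ↪ Fin d) (k : Fin 8)
    (x : Fin 13 ⊕ {l // l ∉ Set.range σ}) :
    familyCoeff hS (σ, k) (tripleIndex hS σ x) = tripleCoeff σ k x :=
  (tripleIndex_injective hS σ).extend_apply _ _ _

theorem familyCoeff_of_notMem (hS : Set.range S = yuOhFamily d) (σ : Fin 3 ↪ Fin d) (k : Fin 8)
    {i : Fin n} (hi : i ∉ Set.range (tripleIndex hS σ)) : familyCoeff hS (σ, k) i = 0 :=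
  Function.extend_apply' _ _ _ hi

theorem sum_familyCoeff_smul (hS : Set.range S = yuOhFamily d) (σ : Fin 3 ↪ Fin d) (k : Fin 8)
    (P : Fin n → Matrix (Fin D) (Fin D) ℂ) :
    ∑ i, familyCoeff hS (σ, k) i • P i =
      ∑ x, tripleCoeff σ k x • P (tripleIndex hS σ x) := by
  refine (Fintype.sum_of_injective _ (tripleIndex_injective hS σ) _ _ (fun i hi => ?_)
    fun x => ?_).symm
  · rw [familyCoeff_of_notMem hS σ k hi, zero_smul]
  · rw [familyCoeff_tripleIndex]

theorem linearRelations_family (hS : Set.range S = yuOhFamily d) :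
    LinearRelations (familyCoeff hS) familyConst S := by
  rintro ⟨σ, k⟩
  rw [sum_familyCoeff_smul]
  simp only [apply_tripleIndex]
  exact sum_tripleCoeff_smul_rayProj σ k

theorem exists_eq_rayProj (hS : Set.range S = yuOhFamily d) (i : Fin n) :
    ∃ (σ : Fin 3 ↪ Fin d) (a : Fin 13), S i = rayProj (place σ (yuOh a)) := by
  have : S i ∈ yuOhFamily d := hS ▸ Set.mem_range_self i
  obtain ⟨⟨σ, a⟩, h⟩ := this
  exact ⟨σ, a, h.symm⟩

theorem isStarProjection_family (hS : Set.range S = yuOhFamily d) (i : Fin n) :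
    IsStarProjection (S i) := by
  obtain ⟨σ, a, h⟩ := exists_eq_rayProj hS i
  exact h ▸ rayProj_isStarProjection _

theorem isRealFamily_family (hS : Set.range S = yuOhFamily d) : IsRealFamily S := by
  intro i a b
  obtain ⟨σ, x, h⟩ := exists_eq_rayProj hS i
  rw [h]
  exact Complex.ofReal_im _

/-- Commuting members of the family are orthogonal, so the products penalized by the functional
vanish on the family itself. -/
theorem mul_eq_zero_of_adj (hinj : Function.Injective S) (hS : Set.range S = yuOhFamily d)
    {i j : Fin n} (h : (compatGraph S).Adj i j) : S i * S j = 0 := by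
  obtain ⟨σ, a, hi⟩ := exists_eq_rayProj hS i
  obtain ⟨τ, b, hj⟩ := exists_eq_rayProj hS j
  obtain ⟨hne, hcomm⟩ := h
  have hne' : S i ≠ S j := fun h => hne (hinj h)
  rw [hi, hj] at hne' hcomm ⊢
  exact rayProj_mul_eq_zero (dot_eq_zero_of_commute
    (by rw [place_dot]; exact yuOh_dot_self_ne a) (by rw [place_dot]; exact yuOh_dot_self_ne b)
    hne' hcomm)

theorem adj_of_dot_eq_zero {u v : Fin d → ℤ} {i j : Fin n} (hu : u ⬝ᵥ u ≠ 0)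
    (hi : S i = rayProj u) (hj : S j = rayProj v) (h : u ⬝ᵥ v = 0) : (compatGraph S).Adj i j := by
  have h1 : S i * S j = 0 := by rw [hi, hj, rayProj_mul_eq_zero h]
  have h2 : S j * S i = 0 := by
    rw [hi, hj, rayProj_mul_eq_zero (by rw [dotProduct_comm, h])]
  refine ⟨?_, h1.trans h2.symm⟩
  rintro rfl
  have h3 : rayProj u = 0 := by
    rw [← (rayProj_isStarProjection u).isIdempotentElem.eq, ← hi, h1]
  obtain ⟨k, hk⟩ : ∃ k, u k ≠ 0 := by
    by_contra hall
    push Not at hall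
    exact hu (by simp [dotProduct, hall])
  have h4 := congrFun (congrFun h3 k) k
  rw [rayProj_apply, Matrix.zero_apply, Complex.ofReal_eq_zero, div_eq_zero_iff] at h4
  rcases h4 with h4 | h4
  · exact hk (mul_self_eq_zero.1 (by exact_mod_cast h4))
  · exact hu (by exact_mod_cast h4)

theorem gram_family_eq_zero (hS : Set.range S = yuOhFamily d) (i j : Fin n) (hij : i ≠ j)
    (hadj : ¬ (compatGraph S).Adj i j) : gram (familyCoeff hS) i j = 0 := by
  rw [gram, Fintype.sum_prod_type]
  refine Finset.sum_eq_zero fun σ _ => ?_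
  by_cases hi : i ∈ Set.range (tripleIndex hS σ)
  · by_cases hj : j ∈ Set.range (tripleIndex hS σ)
    · obtain ⟨x, rfl⟩ := hi
      obtain ⟨y, rfl⟩ := hj
      simp only [familyCoeff_tripleIndex]
      exact sum_tripleCoeff_mul_eq_zero σ (fun h => hij (by rw [h])) fun h =>
        hadj (adj_of_dot_eq_zero (tripleRay_dot_self_ne σ x) (apply_tripleIndex hS σ x)
          (apply_tripleIndex hS σ y) h)
    · simp only [familyCoeff_of_notMem hS σ _ hj, mul_zero, Finset.sum_const_zero]
  · simp only [familyCoeff_of_notMem hS σ _ hi, zero_mul, Finset.sum_const_zero]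

theorem sosWeight_family_pos (hinj : Function.Injective S) (hS : Set.range S = yuOhFamily d)
    (i : Fin n) : 0 < sosWeight (familyCoeff hS) familyConst i := by
  rw [sosWeight, Fintype.sum_prod_type]
  refine Finset.sum_pos' (fun σ _ => ?_) ?_
  · by_cases hi : i ∈ Set.range (tripleIndex hS σ)
    · obtain ⟨x, rfl⟩ := hi
      simp only [familyCoeff_tripleIndex]
      exact (sum_tripleCoeff_weight_pos σ x).le
    · simp [familyCoeff_of_notMem hS σ _ hi]
  · obtain ⟨σ, a, h⟩ := exists_eq_rayProj hS i
    have hi : i = tripleIndex hS σ (Sum.inl a) :=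
      hinj (h.trans (apply_tripleIndex hS σ (Sum.inl a)).symm)
    refine ⟨σ, Finset.mem_univ _, ?_⟩
    rw [hi]
    simp only [familyCoeff_tripleIndex]
    exact sum_tripleCoeff_weight_pos σ _

open Classical in
/-- A realization of the family, as a function of the rays. Vectors whose projector is not in the
family are sent to zero. -/
noncomputable def rayValue (S : Fin n → Matrix (Fin d) (Fin d) ℂ)
    (P : Fin n → Matrix (Fin D) (Fin D) ℂ) (u : Fin d → ℤ) : Matrix (Fin D) (Fin D) ℂ :=
  if h : ∃ i, S i = rayProj u then P h.choose else 0

theorem rayValue_eq (hinj : Function.Injective S) (P : Fin n → Matrix (Fin D) (Fin D) ℂ)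
    {u : Fin d → ℤ} {i : Fin n} (h : S i = rayProj u) : rayValue S P u = P i := by
  have hex : ∃ i, S i = rayProj u := ⟨i, h⟩
  rw [rayValue, dif_pos hex, hinj (hex.choose_spec.trans h.symm)]

theorem rayRealization_rayValue (hinj : Function.Injective S) (hS : Set.range S = yuOhFamily d)
    {P : Fin n → Matrix (Fin D) (Fin D) ℂ} (hP : ∀ i, IsStarProjection (P i))
    (hrel : LinearRelations (familyCoeff hS) familyConst P)
    (horth : ∀ i j, (compatGraph S).Adj i j → P i * P j = 0) :
    RayRealization (rayValue S P) := by
  have hval : ∀ σ x, rayValue S P (tripleRay σ x) = P (tripleIndex hS σ x) := fun σ x =>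
    rayValue_eq hinj P (apply_tripleIndex hS σ x)
  refine ⟨fun σ x => ?_, fun σ x y h => ?_, fun σ k => ?_⟩
  · rw [hval]
    exact hP _
  · rw [hval, hval]
    exact horth _ _ (adj_of_dot_eq_zero (tripleRay_dot_self_ne σ x) (apply_tripleIndex hS σ x)
      (apply_tripleIndex hS σ y) h)
  · simp only [hval]
    rw [← sum_familyCoeff_smul]
    exact hrel (σ, k)

/-- Projectors that satisfy the relations of the family are a multiple of it. -/
theorem equivUnitary_of_relations (hd : 3 ≤ d) (hinj : Function.Injective S)
    (hS : Set.range S = yuOhFamily d)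
    {P : Fin n → Matrix (Fin D) (Fin D) ℂ} (hP : ∀ i, IsStarProjection (P i))
    (hrel : LinearRelations (familyCoeff hS) familyConst P)
    (horth : ∀ i j, (compatGraph S).Adj i j → P i * P j = 0) : EquivUnitary S P := by
  have hG := rayRealization_rayValue hinj hS hP hrel horth
  refine (hG.isMatrixUnits hd).equivUnitary ⟨0, by omega⟩ fun v => ?_
  obtain ⟨σ, a, h⟩ := exists_eq_rayProj hS v
  rw [← rayValue_eq hinj P h, hG.eq_sum, h]
  simp only [Complex.coe_smul, rayProj_apply]

end Family

end CFR

theorem mainTheorem1 (d : ℕ) (hd : 3 ≤ d) :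
    ∃ (n : ℕ) (S : Fin n → Matrix (Fin d) (Fin d) ℂ) (W : CFR.Witness n) (Q C : ℝ),
      -- `S` is a set of `n` projectors and `W` is a witness on its graph of compatibility
      (∀ i, IsStarProjection (S i)) ∧ Function.Injective S ∧ W.graph = CFR.compatGraph S ∧
      -- every state gives the value `Q`
      (∀ ρ : Matrix (Fin d) (Fin d) ℂ, CFR.IsState ρ → W.value S ρ = Q) ∧
      -- `C` is the noncontextual bound, it is the weighted independence number, and `Q` exceeds it
      IsGreatest W.nchvValues C ∧ C = CFR.weightedIndepNum W.graph W.w ∧ C < Q ∧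
      -- certification with any full-rank state in any dimension
      (∀ (D : ℕ) (S' : Fin n → Matrix (Fin D) (Fin D) ℂ) (ρ' : Matrix (Fin D) (Fin D) ℂ),
        W.IsRealization S' → CFR.IsState ρ' → ρ'.rank = D → W.value S' ρ' = Q →
          CFR.EquivUpToConj S S' ∧ (CFR.IsRealFamily S → CFR.EquivUnitary S S')) ∧
      -- the set can be chosen real in every dimension from four on
      (4 ≤ d → CFR.IsRealFamily S) := by
  -- Enumerating the projectors, rather than the labels of the rays, makes the family injective.
  obtain ⟨n, S, hinj, hS⟩ := (Set.finite_range fun p : (Fin 3 ↪ Fin d) × Fin 13 =>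
    CFR.rayProj (CFR.place p.1 (CFR.yuOh p.2))).fin_param
  have hS' : Set.range S = CFR.yuOhFamily d := hS
  have hG := CFR.gram_family_eq_zero hS'
  refine ⟨n, S, CFR.sosWitness (CFR.familyCoeff hS') CFR.familyConst (CFR.compatGraph S)
    (CFR.sosWeight_family_pos hinj hS'), ∑ k, CFR.familyConst (d := d) k ^ 2, _,
    CFR.isStarProjection_family hS', hinj, rfl, fun ρ hρ => ?_, CFR.Witness.isGreatest_nchvValues _,
    rfl, ?_, fun D S' ρ' hreal hρ' hr hQ => ?_, fun _ => CFR.isRealFamily_family hS'⟩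
  · exact CFR.sosWitness_value_eq_of_relations hG (CFR.isStarProjection_family hS')
      (CFR.linearRelations_family hS') (fun i j h => CFR.mul_eq_zero_of_adj hinj hS' h) hρ
  · exact CFR.weightedIndepNum_lt (S := S) (by omega)
      (hw := CFR.sosWeight_family_pos hinj hS') hG fun D P hP hrel horth =>
        CFR.equivUnitary_of_relations hd hinj hS' hP hrel horth
  · obtain ⟨hrel, horth⟩ := CFR.relations_of_value_eq hG hreal hρ' hr hQ
    have h := CFR.equivUnitary_of_relations hd hinj hS' hreal.1 hrel horth
    -- The family is real, so that no conjugate summand is needed.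
    exact ⟨h.equivUpToConj, fun _ => h⟩
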